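/- Let $f:\mathbb{R}\to[-1,1]$ be a (measurable) link function. For $Z\sim\mathcal N(0,1)$ put $\mu_k:=\mathbb{E}[f(Z)Z^k]$, $\phi(f):=\mu_1^2-\mu_0\mu_2+\mu_0^2$, and let $$\gamma:=\frac12\left[\frac{1-\mu_0^2}{\phi(f)+1-\mu_0^2}+1\right],\qquad \xi:=\frac{\gamma\,\phi(f)+(\gamma-1)(1-\mu_0^2)}{(1+\gamma)\,[\phi(f)+1-\mu_0^2]}.$$ Let $\beta^*\in\mathbb{R}^p$ with $\|\beta^*\|_2=1$. The pair $(Y,X)\in\{-1,1\}\times\mathbb{R}^p$ satisfies $X\sim\mathcal N(0,I_p)$ and $\mathbb{P}(Y=1\mid X)=\tfrac12 f(\langle X,\beta^*\rangle)+\tfrac12$. Let $(y_1,x_1),\dots,(y_n,x_n)$ be i.i.d. copies of $(Y,X)$ with $n$ even, and let $$M:=\frac2n\sum_{i=1}^{n/2}(y_{2i}-y_{2i-1})^2(x_{2i}-x_{2i-1})(x_{2i}-x_{2i-1})^\top .$$ For a unit vector $\beta^0\in\mathbb{R}^p$ let $\beta^{t}:=M\beta^{t-1}/\|M\beta^{t-1}\|_2$,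 $t\ge1$, be the power iterates. Let $\widehat\beta$ be a unit eigenvector of $M$ for its largest eigenvalue, with its sign chosen so that $\langle\widehat\beta,\beta^*\rangle\ge0$, and let $\alpha:=\langle\beta^0,\widehat\beta\rangle$. **Theorem.** There is an absolute constant $C_2>0$ and, for every $c>0$, there are constants $C_1,C_3>0$ depending only on $c$, such that the following holds for every link function $f$ with $\phi(f)>0$ and $\phi(f)+1-\mu_0^2\ge c$. (Every $f$ with $\phi(f)>0$ satisfies the second condition for some $c>0$, so the constants depend on $f$ only through a lower bound on $\phi(f)+1-\mu_0^2$.) We have $\gamma\in(0,1)$. For all $p$, all $\beta^*$ and all even $n\ge C_1p/\xi^2$, with probability at least $1-2\exp(-C_2p)$ one has, simultaneously for all unit vectors $\beta^0$ (which may therefore be chosen at random) with $\alpha\neq0$ and all $t\ge1$, $$\bigl\|\beta^t-\operatorname{sign}(\alpha)\,\beta^*\bigr\|_2\le C_3\cdot\frac{\phi(f)+1-\mu_0^2}{\phi(f)}\cdot\sqrt{\frac pn}+\sqrt{\frac{1-\alpha^2}{\alpha^2}}\cdot\gamma^t .$$ In particular, $\|\beta^t-\beta^*\|_2$ is so bounded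 if $\alpha>0$. Consequently, on the same event, $\|\beta^t-\operatorname{sign}(\alpha)\beta^*\|_2\le 2C_3\,\frac{\phi(f)+1-\mu_0^2}{\phi(f)}\sqrt{p/n}$ for all sufficiently large $t$. -/

import Mathlib

open MeasureTheory ProbabilityTheory Filter

noncomputable section

namespace OneBit

/-- The moment `μ_k = E[f(Z) Z^k]` of the link function `f`, where `Z ∼ N(0, 1)`. -/
def mu (f : ℝ → ℝ) (k : ℕ) : ℝ := ∫ z, f z * z ^ k ∂(gaussianReal 0 1)

/-- `φ(f) = μ₁² - μ₀ μ₂ + μ₀²`. -/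
def phi (f : ℝ → ℝ) : ℝ := mu f 1 ^ 2 - mu f 0 * mu f 2 + mu f 0 ^ 2

/-- The contraction factor `γ` of the power method. -/
def gam (f : ℝ → ℝ) : ℝ :=
  ((1 - mu f 0 ^ 2) / (phi f + 1 - mu f 0 ^ 2) + 1) / 2

/-- The tolerance `ξ` that enters the sample size requirement. -/
def xi (f : ℝ → ℝ) : ℝ :=
  (gam f * phi f + (gam f - 1) * (1 - mu f 0 ^ 2)) /
    ((1 + gam f) * (phi f + 1 - mu f 0 ^ 2))

/-- The pair `(Y, X)` follows the binary single-index model with link function `f` and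
parameter `β`: `Y` takes its values in `{-1, 1}` and
`P(Y = 1 | X) = f(⟨X, β⟩) / 2 + 1 / 2` almost surely. -/
structure FollowsModel {Ω : Type*} [MeasurableSpace Ω] (P : Measure Ω) {p : ℕ}
    (f : ℝ → ℝ) (β : EuclideanSpace ℝ (Fin p))
    (Y : Ω → ℝ) (X : Ω → EuclideanSpace ℝ (Fin p)) : Prop where
  measurable_Y : Measurable Y
  measurable_X : Measurable X
  binary : ∀ᵐ ω ∂P, Y ω = -1 ∨ Y ω = 1
  cond_prob : P⟦{ω | Y ω = 1} | MeasurableSpace.comap X inferInstance⟧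
    =ᵐ[P] fun ω => 1 / 2 * f (inner ℝ (X ω) β) + 1 / 2

/-- `(y i, x i)`, `i < n`, are i.i.d. observations of a pair `(Y, X)` that follows the model and
has covariate `X ∼ N(0, I_p)`. (The law of `X` and the conditional law of `Y` given `X` determine
the law of the pair, so the observations are identically distributed.) -/
structure IsSample {Ω : Type*} [MeasurableSpace Ω] (P : Measure Ω) {p n : ℕ}
    (f : ℝ → ℝ) (β : EuclideanSpace ℝ (Fin p))
    (y : Fin n → Ω → ℝ) (x : Fin n → Ω → EuclideanSpace ℝ (Fin p)) : Prop where
  model : ∀ i, FollowsModel P f β (y i) (x i)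
  gaussian : ∀ i, P.map (x i) = stdGaussian (EuclideanSpace ℝ (Fin p))
  indep : iIndepFun (fun i ω => (y i ω, x i ω)) P

/-- The pairwise-difference second moment matrix
`M = (2 / n) ∑_{i = 1}^{n / 2} (y_{2i} - y_{2i-1})² (x_{2i} - x_{2i-1}) (x_{2i} - x_{2i-1})ᵀ`.
Observations are numbered from `0` here, so the `i`-th pair consists of the numbers
`2 i` and `2 i + 1`, for `i < n / 2`. -/
def secondMoment {p n : ℕ} (y : Fin n → ℝ) (x : Fin n → EuclideanSpace ℝ (Fin p)) :
    Matrix (Fin p) (Fin p) ℝ :=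
  (2 / (n : ℝ)) • ∑ i : Fin (n / 2),
    (y ⟨2 * i + 1, by omega⟩ - y ⟨2 * i, by omega⟩) ^ 2 •
      Matrix.vecMulVec
        (fun j => x ⟨2 * i + 1, by omega⟩ j - x ⟨2 * i, by omega⟩ j)
        (fun j => x ⟨2 * i + 1, by omega⟩ j - x ⟨2 * i, by omega⟩ j)

/-- The power iterates `β^0 = b`, `β^{t+1} = M β^t / ‖M β^t‖₂`. -/
def powerIterate {p : ℕ} (M : Matrix (Fin p) (Fin p) ℝ) (b : EuclideanSpace ℝ (Fin p)) :
    ℕ → EuclideanSpace ℝ (Fin p)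
  | 0 => b
  | t + 1 =>
    ‖Matrix.toEuclideanLin M (powerIterate M b t)‖⁻¹ •
      Matrix.toEuclideanLin M (powerIterate M b t)

/-- `v` is a unit eigenvector of the symmetric matrix `M` for its largest eigenvalue. -/
def IsLeadingEigenvector {p : ℕ} (M : Matrix (Fin p) (Fin p) ℝ)
    (v : EuclideanSpace ℝ (Fin p)) : Prop :=
  ‖v‖ = 1 ∧ ∃ l : ℝ, Module.End.HasEigenvector (Matrix.toEuclideanLin M) l v ∧
    ∀ l' : ℝ, Module.End.HasEigenvalue (Matrix.toEuclideanLin M) l' → l' ≤ l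

end OneBit

end

/-!
The matrix `M` is an average of `n / 2` independent terms, and
since the responses are signs, `(Y₂ - Y₁)² = 2 - 2 Y₁ Y₂`; splitting `⟨X, v⟩` into a multiple of
`⟨X, β*⟩` and an uncorrelated, hence independent, Gaussian variable gives
`E ⟨v, M v⟩ = 4 (1 - μ₀²) ‖v‖² + 4 φ(f) ⟨v, β*⟩²` (`integral_pair`). So `E M` is a spiked matrix
with leading eigenvector `β*` and spectral gap `4 φ(f)`.

For a fixed unit vector `v` the terms of `⟨v, M v⟩` are nonnegative and have an exponential moment
bounded by an absolute constant, so a Bernstein-type Chernoff bound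
(`measure_abs_sum_sub_ge_le`) controls the deviation by a multiple of `√(p / n)` outside an event
of probability `2 exp (-3 p)`. A `1/2`-net of the sphere has at most `5 ^ p ≤ exp (2 p)` points
(`exists_net_sphere`), and control on such a net is control everywhere (`abs_inner_le_of_net`);
hence `‖M - E M‖ = O(√(p / n))` with probability at least `1 - 2 exp (-p)`
(`exists_event_close`).

The rest is deterministic. The sample size makes the deviation at most `4 ξ (φ + 1 - μ₀²)`, which is
the size of perturbation for which the quotient of the two largest eigenvalues of `M` is still at
most `γ` (`eigenvalue_ratio`). The power method then converges to `± β̂` at the rate `γ ^ t`, with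
the tangent of the initial angle as constant (`IsPerturbedSpike.norm_powerIterate_sub_le`), and
`‖β̂ - β*‖` is of the order of `‖M - E M‖ / φ(f)` by a Davis-Kahan argument
(`IsPerturbedSpike.norm_sub_spike_le`).
-/

namespace OneBit

/-! ### Perturbed spiked operators and the power method -/

section Deterministic

variable {E : Type*} [NormedAddCommGroup E] [InnerProductSpace ℝ E]

open scoped RealInnerProductSpace

/-- The numerical radius of a symmetric operator bounds its operator norm (polarization). -/
lemma norm_apply_le_of_abs_inner_le {A : E →ₗ[ℝ] E} (hA : A.IsSymmetric) {δ : ℝ}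
    (h : ∀ v, |⟪A v, v⟫| ≤ δ * ‖v‖ ^ 2) (v : E) : ‖A v‖ ≤ δ * ‖v‖ := by
  have key : ∀ u : E, ‖u‖ = ‖v‖ → ⟪A v, u⟫ ≤ δ * ‖v‖ ^ 2 := by
    intro u hu
    have e1 := (abs_le.mp (h (v + u))).2
    have e2 := (abs_le.mp (h (v - u))).1
    have e3 : ⟪A u, v⟫ = ⟪A v, u⟫ := by rw [hA u v, real_inner_comm]
    have e4 := parallelogram_law_with_norm ℝ v u
    simp only [map_add, map_sub, inner_add_left, inner_add_right, inner_sub_left,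
      inner_sub_right, e3] at e1 e2
    rw [hu] at e4
    have e5 := congrArg (δ * ·) e4
    linarith
  rcases eq_or_ne (A v) 0 with h0 | h0
  · rcases eq_or_ne v 0 with rfl | hv
    · simp
    · have := h v
      have hv' : 0 < ‖v‖ := norm_pos_iff.mpr hv
      rw [h0, inner_zero_left, abs_zero] at this
      rw [h0, norm_zero]
      by_contra hc
      push Not at hc
      nlinarith
  · have hpos : 0 < ‖A v‖ := norm_pos_iff.mpr h0
    have hv : 0 < ‖v‖ := by
      rw [norm_pos_iff]; rintro rfl; simp at h0
    have := key ((‖v‖ / ‖A v‖) • A v) (by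
      rw [norm_smul, Real.norm_of_nonneg (by positivity)]; field_simp)
    rw [inner_smul_right, real_inner_self_eq_norm_sq] at this
    have e : ‖v‖ / ‖A v‖ * ‖A v‖ ^ 2 = ‖v‖ * ‖A v‖ := by field_simp
    rw [e] at this
    by_contra hc
    push Not at hc
    nlinarith

/-- Control of the quadratic form of a symmetric operator on a `1/2`-net of the unit sphere gives
control everywhere. For unit vectors `‖v - u‖ * ‖v + u‖ ≤ √15 / 4 < 1` as soon as `‖v - u‖ ≤ 1/2`,
so a net this coarse suffices. -/
lemma abs_inner_le_of_net [FiniteDimensional ℝ E] {A : E →ₗ[ℝ] E} (hA : A.IsSymmetric)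
    {N : Finset E} (hN1 : ∀ u ∈ N, ‖u‖ = 1)
    (hN : ∀ v : E, ‖v‖ = 1 → ∃ u ∈ N, ‖v - u‖ ≤ 1 / 2) {δ : ℝ}
    (h : ∀ u ∈ N, |⟪A u, u⟫| ≤ δ) (v : E) : |⟪A v, v⟫| ≤ 40 * δ * ‖v‖ ^ 2 := by
  rcases eq_or_ne v 0 with rfl | hv
  · simp
  have hv' : 0 < ‖v‖ := norm_pos_iff.mpr hv
  have hAc : Continuous A := A.continuous_of_finiteDimensional
  have hne : (Metric.sphere (0 : E) 1).Nonempty :=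
    ⟨‖v‖⁻¹ • v, by simp [norm_smul, hv'.ne']⟩
  obtain ⟨z, hz, hmax⟩ := (isCompact_sphere (0 : E) 1).exists_isMaxOn hne
    (f := fun w => |⟪A w, w⟫|) (by fun_prop)
  have hz1 : ‖z‖ = 1 := by simpa using hz
  set B := |⟪A z, z⟫| with hB
  have hB0 : 0 ≤ B := abs_nonneg _
  have hq : ∀ w : E, |⟪A w, w⟫| ≤ B * ‖w‖ ^ 2 := by
    intro w
    rcases eq_or_ne w 0 with rfl | hw
    · simp
    have hw' : 0 < ‖w‖ := norm_pos_iff.mpr hw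
    have := hmax (show ‖w‖⁻¹ • w ∈ Metric.sphere (0 : E) 1 by simp [norm_smul, hw'.ne'])
    simp only [Set.mem_ofPred_eq, map_smul, inner_smul_left, inner_smul_right, abs_mul] at this
    simp only [map_inv₀, conj_trivial, abs_inv, abs_norm] at this
    rw [← mul_assoc, ← mul_inv, inv_mul_le_iff₀ (by positivity)] at this
    linarith
  obtain ⟨u, hu, huz⟩ := hN z hz1
  have hu1 := hN1 u hu
  have hid : ⟪A z, z⟫ - ⟪A u, u⟫ = ⟪A (z - u), z + u⟫ := by
    have e3 : ⟪A u, z⟫ = ⟪A z, u⟫ := by rw [hA u z, real_inner_comm]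
    simp only [map_sub, inner_sub_left, inner_add_right, e3]
    ring
  have hle : |⟪A (z - u), z + u⟫| ≤ B * (‖z - u‖ * ‖z + u‖) := by
    calc _ ≤ ‖A (z - u)‖ * ‖z + u‖ := abs_real_inner_le_norm _ _
      _ ≤ (B * ‖z - u‖) * ‖z + u‖ := by
        gcongr; exact norm_apply_le_of_abs_inner_le hA hq _
      _ = _ := by ring
  have hprod : ‖z - u‖ * ‖z + u‖ ≤ 39 / 40 := by
    have e4 := parallelogram_law_with_norm ℝ z u
    rw [hz1, hu1] at e4
    have h0 := norm_nonneg (z - u)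
    have h1 : ‖z - u‖ ^ 2 ≤ 1 / 4 := by nlinarith
    have h2 : ‖z + u‖ ^ 2 = 4 - ‖z - u‖ ^ 2 := by nlinarith
    refine abs_le_of_sq_le_sq' ?_ (by norm_num) |>.2
    rw [mul_pow, h2]
    nlinarith [sq_nonneg (‖z - u‖)]
  have hfin : B ≤ 40 * δ := by
    have h1 : B ≤ |⟪A u, u⟫| + |⟪A (z - u), z + u⟫| := by
      have : ⟪A z, z⟫ = ⟪A u, u⟫ + ⟪A (z - u), z + u⟫ := by linarith
      rw [hB, this]; exact abs_add_le _ _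
    have h2 : B * (‖z - u‖ * ‖z + u‖) ≤ B * (39 / 40) := by gcongr
    linarith [h u hu]
  exact (hq v).trans (by gcongr)

/-- The unit sphere has a `1/2`-net with at most `5 ^ dim` points. -/
lemma exists_net_sphere [FiniteDimensional ℝ E] :
    ∃ N : Finset E, N.card ≤ 5 ^ Module.finrank ℝ E ∧ (∀ u ∈ N, ‖u‖ = 1) ∧
      ∀ v : E, ‖v‖ = 1 → ∃ u ∈ N, ‖v - u‖ ≤ 1 / 2 := by
  classical
  -- `S k`: there is a `1/2`-separated set of `k` unit vectors; a largest one is a net.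
  let S : ℕ → Prop := fun k => ∃ N : Finset E, N.card = k ∧ (∀ u ∈ N, ‖u‖ = 1) ∧
    ∀ u ∈ N, ∀ v ∈ N, u ≠ v → 1 / 2 ≤ ‖u - v‖
  have hcard : ∀ N : Finset E, (∀ u ∈ N, ‖u‖ = 1) →
      (∀ u ∈ N, ∀ v ∈ N, u ≠ v → 1 / 2 ≤ ‖u - v‖) → N.card ≤ 5 ^ Module.finrank ℝ E := by
    intro N h1 h2
    have hinj : Function.Injective fun u : E => (2 : ℝ) • u :=
      smul_right_injective E two_ne_zero
    rw [← Finset.card_image_of_injective N hinj]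
    apply Besicovitch.card_le_of_separated
    · intro c hc
      obtain ⟨u, hu, rfl⟩ := Finset.mem_image.mp hc
      simp [norm_smul, h1 u hu]
    · intro c hc d hd hcd
      obtain ⟨u, hu, rfl⟩ := Finset.mem_image.mp hc
      obtain ⟨w, hw, rfl⟩ := Finset.mem_image.mp hd
      have := h2 u hu w hw (fun e => hcd (by rw [e]))
      rw [← smul_sub, norm_smul, Real.norm_ofNat]
      linarith
  have hS0 : S 0 := ⟨∅, by simp⟩
  obtain ⟨N, hNk, h1, h2⟩ : S (Nat.findGreatest S (5 ^ Module.finrank ℝ E)) :=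
    Nat.findGreatest_spec (Nat.zero_le _) hS0
  refine ⟨N, hcard N h1 h2, h1, fun v hv => ?_⟩
  by_contra hc
  push Not at hc
  have hvN : v ∉ N := fun hvN => by have := hc v hvN; norm_num at this
  have h1' : ∀ u ∈ insert v N, ‖u‖ = 1 := by
    intro u hu
    rcases Finset.mem_insert.mp hu with rfl | hu
    exacts [hv, h1 u hu]
  have h2' : ∀ u ∈ insert v N, ∀ w ∈ insert v N, u ≠ w → 1 / 2 ≤ ‖u - w‖ := by
    intro u hu w hw huw
    rcases Finset.mem_insert.mp hu with rfl | hu' <;>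
      rcases Finset.mem_insert.mp hw with rfl | hw'
    · exact absurd rfl huw
    · exact (hc w hw').le
    · rw [norm_sub_rev]; exact (hc u hu').le
    · exact h2 u hu' w hw' huw
  have hle := Nat.le_findGreatest (P := S) (hcard _ h1' h2') ⟨insert v N, rfl, h1', h2'⟩
  rw [Finset.card_insert_of_notMem hvN] at hle
  omega

/-- The largest eigenvalue of a symmetric operator dominates its quadratic form. -/
lemma inner_apply_self_le_of_forall_hasEigenvalue_le [FiniteDimensional ℝ E] {T : E →ₗ[ℝ] E}
    (hT : T.IsSymmetric) {l : ℝ} (hl : ∀ l', Module.End.HasEigenvalue T l' → l' ≤ l) (v : E) :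
    ⟪T v, v⟫ ≤ l * ‖v‖ ^ 2 := by
  rcases eq_or_ne v 0 with rfl | hv
  · simp
  have : Nontrivial E := ⟨v, 0, hv⟩
  have hsup := hl _ hT.hasEigenvalue_iSup_of_finiteDimensional
  have hv' : 0 < ‖v‖ := norm_pos_iff.mpr hv
  have hbdd : BddAbove (Set.range fun x : {x : E // x ≠ 0} =>
      RCLike.re ⟪T x, (x : E)⟫ / ‖(x : E)‖ ^ 2) := by
    refine ⟨‖LinearMap.toContinuousLinearMap T‖, ?_⟩
    rintro _ ⟨⟨x, hx⟩, rfl⟩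
    have hx' : 0 < ‖x‖ := norm_pos_iff.mpr hx
    simp only [RCLike.re_to_real]
    rw [div_le_iff₀ (by positivity)]
    calc ⟪T x, x⟫ ≤ ‖T x‖ * ‖x‖ := real_inner_le_norm _ _
      _ ≤ (‖LinearMap.toContinuousLinearMap T‖ * ‖x‖) * ‖x‖ := by
        gcongr; exact (LinearMap.toContinuousLinearMap T).le_opNorm x
      _ = _ := by ring
  have h1 := (le_ciSup hbdd ⟨v, hv⟩).trans hsup
  simp only [RCLike.re_to_real] at h1
  rwa [div_le_iff₀ (by positivity)] at h1

/-- A bound on the quadratic form of a positive semidefinite operator `T` at `v` and at `T v`, for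
instance on an invariant subspace, bounds `‖T v‖`: Cauchy-Schwarz for the form `⟪T ·, ·⟫`. -/
lemma norm_apply_le_of_inner_le {T : E →ₗ[ℝ] E} (hT : T.IsSymmetric)
    (hpos : ∀ v, 0 ≤ ⟪T v, v⟫) {κ : ℝ} {v : E}
    (h1 : ⟪T v, v⟫ ≤ κ * ‖v‖ ^ 2) (h2 : ⟪T (T v), T v⟫ ≤ κ * ‖T v‖ ^ 2) :
    ‖T v‖ ≤ κ * ‖v‖ := by
  rcases eq_or_ne (T v) 0 with h0 | h0
  · rcases eq_or_ne v 0 with rfl | hv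
    · simp
    · rw [h0, inner_zero_left] at h1
      have : 0 < ‖v‖ := norm_pos_iff.mpr hv
      rw [h0, norm_zero]
      by_contra hc
      push Not at hc
      nlinarith
  have ht : 0 < ‖T v‖ := norm_pos_iff.mpr h0
  have hv : 0 < ‖v‖ := by
    rw [norm_pos_iff]; rintro rfl; simp at h0
  -- nonnegativity of the form at `v - s • T v`, where `s = ‖v‖ / ‖T v‖`
  have hs := hpos (‖T v‖ • v - ‖v‖ • T v)
  have e : ⟪T (T v), v⟫ = ‖T v‖ ^ 2 := by rw [hT, real_inner_self_eq_norm_sq]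
  simp only [map_sub, map_smul, inner_sub_left, inner_sub_right, inner_smul_left,
    inner_smul_right, conj_trivial, e, real_inner_self_eq_norm_sq] at hs
  have h1' := mul_le_mul_of_nonneg_left h1 (sq_nonneg ‖T v‖)
  have h2' := mul_le_mul_of_nonneg_left h2 (sq_nonneg ‖v‖)
  have h3 : (‖v‖ * ‖T v‖ ^ 2) * ‖T v‖ ≤ (‖v‖ * ‖T v‖ ^ 2) * (κ * ‖v‖) := by nlinarith
  exact le_of_mul_le_mul_left h3 (by positivity)

/-- The difference of `T` and the spiked operator `a • 1 + b • β βᵀ`, with its quadratic form. -/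
lemma exists_sub_spike {T : E →ₗ[ℝ] E} (hT : T.IsSymmetric) (a b : ℝ) (β : E) :
    ∃ A : E →ₗ[ℝ] E, A.IsSymmetric ∧ (∀ w, A w = T w - (a • w + (b * ⟪w, β⟫) • β)) ∧
      ∀ w, ⟪A w, w⟫ = ⟪T w, w⟫ - (a * ‖w‖ ^ 2 + b * ⟪w, β⟫ ^ 2) := by
  let A : E →ₗ[ℝ] E := T - (a • LinearMap.id + b • (innerₛₗ ℝ β).smulRight β)
  have hAv : ∀ w, A w = T w - (a • w + (b * ⟪w, β⟫) • β) := by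
    intro w
    simp [A, smul_smul, real_inner_comm]
  refine ⟨A, fun x y => ?_, hAv, fun w => ?_⟩
  · rw [hAv, hAv, inner_sub_left, inner_sub_right, hT x y]
    simp only [inner_add_left, inner_add_right, inner_smul_left, inner_smul_right, conj_trivial]
    rw [real_inner_comm y β]
    ring
  · rw [hAv, inner_sub_left, inner_add_left, inner_smul_left, inner_smul_left,
      real_inner_self_eq_norm_sq, real_inner_comm w β]
    simp only [conj_trivial]
    ring

/-- `T` is a symmetric positive semidefinite operator whose quadratic form is within `δ` of the
one of `a • 1 + b • β βᵀ`, and `v` is a unit eigenvector for its largest eigenvalue `l`; that `l` is the largest one is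
expressed by `l` dominating the quadratic form. -/
structure IsPerturbedSpike (T : E →ₗ[ℝ] E) (a b δ : ℝ) (β : E) (l : ℝ) (v : E) : Prop where
  symm : T.IsSymmetric
  nonneg : ∀ w, 0 ≤ ⟪T w, w⟫
  norm_spike : ‖β‖ = 1
  close : ∀ w, |⟪T w, w⟫ - (a * ‖w‖ ^ 2 + b * ⟪w, β⟫ ^ 2)| ≤ δ * ‖w‖ ^ 2
  norm_vec : ‖v‖ = 1
  apply_vec : T v = l • v
  le_top : ∀ w, ⟪T w, w⟫ ≤ l * ‖w‖ ^ 2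

namespace IsPerturbedSpike

variable {T : E →ₗ[ℝ] E} {a b δ l : ℝ} {β v : E}

lemma le_eigenvalue (h : IsPerturbedSpike T a b δ β l v) : a + b - δ ≤ l := by
  have h1 := h.le_top β
  have h2 := (abs_le.mp (h.close β)).1
  rw [real_inner_self_eq_norm_sq, h.norm_spike] at h2
  rw [h.norm_spike] at h1
  linarith

lemma inner_apply_eq_zero (h : IsPerturbedSpike T a b δ β l v) {w : E} (hw : ⟪v, w⟫ = 0) :
    ⟪v, T w⟫ = 0 := by
  rw [← h.symm, h.apply_vec, inner_smul_left, hw, mul_zero]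

/-- Courant-Fischer for the second eigenvalue: the plane spanned by `v` and `w` meets `β^⊥`. -/
lemma inner_le_of_orthogonal (h : IsPerturbedSpike T a b δ β l v) {w : E} (hw : ⟪v, w⟫ = 0) :
    ⟪T w, w⟫ ≤ (a + δ) * ‖w‖ ^ 2 := by
  have hwv : ⟪w, v⟫ = 0 := by rw [real_inner_comm, hw]
  have hTw : ⟪T w, v⟫ = 0 := by rw [real_inner_comm, h.inner_apply_eq_zero hw]
  set x := ⟪v, β⟫
  set y := ⟪w, β⟫
  rcases eq_or_ne x 0 with hx | hx
  · -- `v` itself is orthogonal to the spike, so already the top eigenvalue is small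
    have h1 := (abs_le.mp (h.close v)).2
    rw [h.apply_vec, inner_smul_left, real_inner_self_eq_norm_sq, h.norm_vec] at h1
    simp only [conj_trivial] at h1
    change l * 1 ^ 2 - (a * 1 ^ 2 + b * x ^ 2) ≤ δ * 1 ^ 2 at h1
    rw [hx] at h1
    have h2 := h.le_top w
    have : l ≤ a + δ := by linarith
    nlinarith [sq_nonneg ‖w‖]
  · have hu := (abs_le.mp (h.close (x • w - y • v))).2
    have hn : ‖x • w - y • v‖ ^ 2 = x ^ 2 * ‖w‖ ^ 2 + y ^ 2 := by
      rw [← real_inner_self_eq_norm_sq]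
      simp only [inner_sub_left, inner_sub_right, inner_smul_left, inner_smul_right, hw, hwv,
        conj_trivial, real_inner_self_eq_norm_sq, h.norm_vec]
      ring
    have h0 : ⟪x • w - y • v, β⟫ = 0 := by
      simp only [inner_sub_left, inner_smul_left, conj_trivial]
      change x * y - y * x = 0
      ring
    have hq : ⟪T (x • w - y • v), x • w - y • v⟫ = x ^ 2 * ⟪T w, w⟫ + y ^ 2 * l := by
      simp only [map_sub, map_smul, inner_sub_left, inner_sub_right, inner_smul_left,
        inner_smul_right, hw, hTw, h.apply_vec, conj_trivial, real_inner_self_eq_norm_sq,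
        h.norm_vec]
      ring
    rw [hn, h0, hq] at hu
    have hx2 : 0 < x ^ 2 := by positivity
    by_contra hc
    push Not at hc
    have h2 := h.le_top w
    rcases eq_or_ne w 0 with rfl | hw0
    · simp at hc
    have hw' : 0 < ‖w‖ ^ 2 := by have := norm_pos_iff.mpr hw0; positivity
    have hl : a + δ ≤ l := by
      by_contra hc'
      push Not at hc'
      nlinarith
    nlinarith [mul_pos hx2 (sub_pos.mpr hc), mul_nonneg (sq_nonneg y) (sub_nonneg.mpr hl)]

lemma norm_pow_apply_le (h : IsPerturbedSpike T a b δ β l v) (ha : 0 ≤ a + δ) {w : E}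
    (hw : ⟪v, w⟫ = 0) (t : ℕ) :
    ⟪v, (T ^ t) w⟫ = 0 ∧ ‖(T ^ t) w‖ ≤ (a + δ) ^ t * ‖w‖ := by
  induction t with
  | zero => simpa using hw
  | succ t ih =>
    rw [pow_succ', Module.End.mul_apply]
    have h0 := h.inner_apply_eq_zero ih.1
    refine ⟨h0, ?_⟩
    calc ‖T ((T ^ t) w)‖ ≤ (a + δ) * ‖(T ^ t) w‖ :=
          norm_apply_le_of_inner_le h.symm h.nonneg (h.inner_le_of_orthogonal ih.1)
            (h.inner_le_of_orthogonal h0)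
      _ ≤ (a + δ) * ((a + δ) ^ t * ‖w‖) := by gcongr; exact ih.2
      _ = _ := by ring

/-- The sine of the angle between the leading eigenvector and the spike is linear in the
perturbation (Davis-Kahan): compare `T v = l • v` with `(a • 1 + b • β βᵀ) v` off the spike. -/
lemma norm_sub_spike_le (h : IsPerturbedSpike T a b δ β l v) (hδ : δ < b)
    (hvβ : 0 ≤ ⟪v, β⟫) : ‖v - β‖ ≤ √2 * (δ / (b - δ)) := by
  set s := ⟪v, β⟫ with hs
  have hδ0 : 0 ≤ δ := by
    have := (abs_nonneg _).trans (h.close v)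
    rwa [h.norm_vec, one_pow, mul_one] at this
  obtain ⟨A, hA, hAv, hAw⟩ := exists_sub_spike h.symm a b β
  have hAq : ∀ w, |⟪A w, w⟫| ≤ δ * ‖w‖ ^ 2 := fun w => by rw [hAw]; exact h.close w
  have hn := norm_apply_le_of_abs_inner_le hA hAq v
  rw [h.norm_vec, mul_one] at hn
  have hββ : ⟪β, β⟫ = 1 := by rw [real_inner_self_eq_norm_sq, h.norm_spike, one_pow]
  have hvv : ⟪v, v⟫ = 1 := by rw [real_inner_self_eq_norm_sq, h.norm_vec, one_pow]
  have hβv : ⟪β, v⟫ = s := by rw [real_inner_comm]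
  have hl := h.le_eigenvalue
  have hs1 : s ≤ 1 := by
    have := real_inner_le_norm v β
    rwa [h.norm_vec, h.norm_spike, one_mul] at this
  have hs2 : 0 ≤ 1 - s ^ 2 := by nlinarith
  -- `v - s • β` is the component of `v` orthogonal to the spike
  have hproj : (l - a) * (1 - s ^ 2) ≤ δ * √(1 - s ^ 2) := by
    have e1 : ⟪A v, v - s • β⟫ = (l - a) * (1 - s ^ 2) := by
      rw [hAv, h.apply_vec]
      simp only [inner_sub_left, inner_sub_right, inner_add_left, inner_smul_left,
        inner_smul_right, conj_trivial, hββ, hvv, hβv, ← hs]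
      ring
    have e2 : ‖v - s • β‖ = √(1 - s ^ 2) := by
      rw [← Real.sqrt_sq (norm_nonneg (v - s • β)), ← real_inner_self_eq_norm_sq]
      congr 1
      simp only [inner_sub_left, inner_sub_right, inner_smul_left,
        inner_smul_right, conj_trivial, hββ, hvv, hβv, ← hs]
      ring
    rw [← e1, ← e2]
    exact (real_inner_le_norm _ _).trans (by gcongr)
  have hsin : √(1 - s ^ 2) ≤ δ / (b - δ) := by
    rw [le_div_iff₀ (by linarith)]
    rcases eq_or_lt_of_le hs2 with h0 | h0
    · rw [← h0]; simpa using hδ0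
    · have hr : 0 < √(1 - s ^ 2) := Real.sqrt_pos.mpr h0
      have hrr : √(1 - s ^ 2) * √(1 - s ^ 2) = 1 - s ^ 2 := Real.mul_self_sqrt hs2
      have : (l - a) * √(1 - s ^ 2) ≤ δ := by
        refine le_of_mul_le_mul_right ?_ hr
        rw [mul_assoc, hrr]; exact hproj
      nlinarith
  calc ‖v - β‖ = √(2 - 2 * s) := by
        rw [← Real.sqrt_sq (norm_nonneg (v - β)), ← real_inner_self_eq_norm_sq]
        congr 1
        simp only [inner_sub_left, inner_sub_right, hββ, hvv, hβv, ← hs]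
        ring
    _ ≤ √(2 * (1 - s ^ 2)) := Real.sqrt_le_sqrt (by nlinarith)
    _ = √2 * √(1 - s ^ 2) := Real.sqrt_mul (by norm_num) _
    _ ≤ _ := by gcongr

end IsPerturbedSpike

/-- The distance of the normalization of `x • v + w` to `± v` is at most the tangent of the angle
between the two. -/
lemma norm_normalize_sub_sign_le {v w : E} {x : ℝ} (hv : ‖v‖ = 1) (hw : ⟪v, w⟫ = 0)
    (hx : x ≠ 0) :
    ‖‖x • v + w‖⁻¹ • (x • v + w) - Real.sign x • v‖ ≤ ‖w‖ / |x| := by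
  have hx' : 0 < |x| := abs_pos.mpr hx
  have hwv : ⟪w, v⟫ = 0 := by rw [real_inner_comm, hw]
  have hvv : ⟪v, v⟫ = 1 := by rw [real_inner_self_eq_norm_sq, hv, one_pow]
  set r := ‖x • v + w‖ with hr
  have hr2 : r ^ 2 = |x| ^ 2 + ‖w‖ ^ 2 := by
    rw [hr, ← real_inner_self_eq_norm_sq, sq_abs]
    simp only [inner_add_left, inner_add_right, inner_smul_left, inner_smul_right, conj_trivial,
      hvv, hwv, hw, real_inner_self_eq_norm_sq]
    ring
  have hxr : |x| ≤ r := abs_le_of_sq_le_sq' (by nlinarith [sq_nonneg ‖w‖]) (norm_nonneg _) |>.2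
  have hr0 : 0 < r := hx'.trans_le hxr
  have hsgn : Real.sign x * x = |x| := by
    rcases lt_or_gt_of_ne hx with h | h
    · rw [Real.sign_of_neg h, abs_of_neg h]; ring
    · rw [Real.sign_of_pos h, abs_of_pos h]; ring
  have hsgn2 : Real.sign x * Real.sign x = 1 := by
    rcases lt_or_gt_of_ne hx with h | h
    · rw [Real.sign_of_neg h]; ring
    · rw [Real.sign_of_pos h]; ring
  have hsq : ‖r⁻¹ • (x • v + w) - Real.sign x • v‖ ^ 2 = 2 - 2 * (|x| / r) := by
    have h1 : ⟪x • v + w, x • v + w⟫ = r ^ 2 := by rw [real_inner_self_eq_norm_sq]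
    have h2 : ⟪x • v + w, v⟫ = x := by
      simp [inner_add_left, inner_smul_left, hwv, hv]
    have h3 : ⟪v, x • v + w⟫ = x := by rw [real_inner_comm, h2]
    rw [← real_inner_self_eq_norm_sq]
    simp only [inner_sub_left, inner_sub_right, inner_smul_left, inner_smul_right, conj_trivial,
      h1, h2, h3, hvv]
    rw [← hsgn]
    have : r⁻¹ * (r⁻¹ * r ^ 2) = 1 := by field_simp
    linear_combination this + hsgn2
  refine abs_le_of_sq_le_sq' ?_ (by positivity) |>.2
  rw [hsq, div_pow, show ‖w‖ ^ 2 = r ^ 2 - |x| ^ 2 by linarith]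
  rw [le_div_iff₀ (by positivity)]
  have : (2 - 2 * (|x| / r)) * |x| ^ 2 = 2 * (r - |x|) * |x| * (|x| / r) := by field_simp
  rw [this]
  have h1 : |x| / r ≤ 1 := (div_le_one hr0).mpr hxr
  have h2 : 0 ≤ 2 * (r - |x|) * |x| := by have := sub_nonneg.mpr hxr; positivity
  nlinarith [mul_le_mul_of_nonneg_left h1 h2, sq_nonneg (r - |x|)]

end Deterministic

lemma powerIterate_eq {p : ℕ} (M : Matrix (Fin p) (Fin p) ℝ) {b : EuclideanSpace ℝ (Fin p)}
    (hb : ‖b‖ = 1) (t : ℕ) :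
    powerIterate M b t =
      ‖(Matrix.toEuclideanLin M ^ t) b‖⁻¹ • (Matrix.toEuclideanLin M ^ t) b := by
  induction t with
  | zero => simp [powerIterate, hb]
  | succ t ih =>
    rw [powerIterate, ih, pow_succ', Module.End.mul_apply]
    set w := (Matrix.toEuclideanLin M ^ t) b
    rcases eq_or_ne w 0 with h0 | h0
    · simp [h0]
    have hw : 0 < ‖w‖ := norm_pos_iff.mpr h0
    rw [map_smul, norm_smul, norm_inv, norm_norm, smul_smul]
    congr 1
    field_simp

/-- The power iterates converge geometrically to a leading eigenvector, at the rate of the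
quotient of the two largest eigenvalues. -/
lemma IsPerturbedSpike.norm_powerIterate_sub_le {p : ℕ} {M : Matrix (Fin p) (Fin p) ℝ}
    {a b δ l γ : ℝ} {β v b₀ : EuclideanSpace ℝ (Fin p)}
    (h : IsPerturbedSpike (Matrix.toEuclideanLin M) a b δ β l v) (ha : 0 ≤ a + δ) (hl : 0 < l)
    (hγ : a + δ ≤ γ * l) (hb : ‖b₀‖ = 1) (h0 : inner ℝ b₀ v ≠ 0) (t : ℕ) :
    ‖powerIterate M b₀ t - Real.sign (inner ℝ b₀ v) • v‖ ≤
      √((1 - (inner ℝ b₀ v) ^ 2) / (inner ℝ b₀ v) ^ 2) * γ ^ t := by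
  set α : ℝ := inner ℝ b₀ v with hα
  set w := b₀ - α • v with hw
  have hvv : inner ℝ v v = (1 : ℝ) := by rw [real_inner_self_eq_norm_sq, h.norm_vec, one_pow]
  have hbb : inner ℝ b₀ b₀ = (1 : ℝ) := by rw [real_inner_self_eq_norm_sq, hb, one_pow]
  have hvb : inner ℝ v b₀ = α := by rw [real_inner_comm]
  have hvw : inner ℝ v w = (0 : ℝ) := by
    rw [hw, inner_sub_right, inner_smul_right, hvv, hvb]; ring
  have hwn : ‖w‖ = √(1 - α ^ 2) := by
    rw [← Real.sqrt_sq (norm_nonneg w), ← real_inner_self_eq_norm_sq, hw]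
    congr 1
    simp only [inner_sub_left, inner_sub_right, inner_smul_left,
      inner_smul_right, conj_trivial, hbb, hvv, hvb, ← hα]
    ring
  obtain ⟨ho, hn⟩ := h.norm_pow_apply_le ha hvw t
  have hTv : (Matrix.toEuclideanLin M ^ t) v = l ^ t • v := by
    clear ho hn
    induction t with
    | zero => simp
    | succ t ih =>
      rw [pow_succ', Module.End.mul_apply, ih, map_smul, h.apply_vec, smul_smul, pow_succ]
  have hdec : (Matrix.toEuclideanLin M ^ t) b₀ =
      (l ^ t * α) • v + (Matrix.toEuclideanLin M ^ t) w := by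
    have : b₀ = α • v + w := by rw [hw]; abel
    conv_lhs => rw [this]
    rw [map_add, map_smul, hTv, smul_smul, mul_comm]
  have hlt : 0 < l ^ t := pow_pos hl t
  have hsgn : Real.sign (l ^ t * α) = Real.sign α := by
    rcases lt_or_gt_of_ne h0 with h | h
    · rw [Real.sign_of_neg h, Real.sign_of_neg (mul_neg_of_pos_of_neg hlt h)]
    · rw [Real.sign_of_pos h, Real.sign_of_pos (mul_pos hlt h)]
  have key := norm_normalize_sub_sign_le h.norm_vec ho (mul_ne_zero hlt.ne' h0)
  rw [powerIterate_eq M hb, hdec, ← hsgn]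
  refine key.trans ?_
  have hα' : 0 < |α| := abs_pos.mpr h0
  rw [Real.sqrt_div' _ (sq_nonneg α), Real.sqrt_sq_eq_abs, ← hwn, abs_mul, abs_of_pos hlt,
    div_le_iff₀ (by positivity)]
  calc _ ≤ (a + δ) ^ t * ‖w‖ := hn
    _ ≤ (γ * l) ^ t * ‖w‖ := by gcongr
    _ = _ := by rw [mul_pow]; field_simp

/-! ### Concentration of sums of independent random variables -/

section Concentration

variable {Ω : Type*} [MeasurableSpace Ω] {P : Measure Ω}

/-- Functions of disjoint blocks of independent random variables are independent. -/
lemma iIndepFun_comp_blocks {ι κ γ : Type*} {S : ι → Type*} [∀ i, MeasurableSpace (S i)]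
    [MeasurableSpace γ] {f : (i : ι) → Ω → S i} (hf : iIndepFun f P) (hm : ∀ i, Measurable (f i))
    (T : κ → Finset ι) (hT : ∀ j k, j ≠ k → Disjoint (T j) (T k))
    {g : (k : κ) → ((i : T k) → S i) → γ} (hg : ∀ k, Measurable (g k)) :
    iIndepFun (fun k ω => g k (fun i => f i ω)) P := by
  classical
  have := hf.isProbabilityMeasure
  rw [iIndepFun_iff_measure_inter_preimage_eq_mul]
  intro A sets hsets
  induction A using Finset.induction_on with
  | empty => simp
  | insert a A ha ih =>
    have hd : Disjoint (T a) (A.biUnion T) := by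
      rw [Finset.disjoint_biUnion_right]
      exact fun k hk => hT a k (fun e => ha (e ▸ hk))
    have hind := hf.indepFun_finset (T a) (A.biUnion T) hd hm
    have hsub : ∀ k : A, ∀ i : T k, (i : ι) ∈ A.biUnion T := fun k i =>
      Finset.mem_biUnion.mpr ⟨k, k.2, i.2⟩
    let B : Set ((i : (A.biUnion T : Finset ι)) → S i) :=
      ⋂ k : A, {z | g k (fun i => z ⟨i, hsub k i⟩) ∈ sets k}
    have hB : MeasurableSet B := MeasurableSet.iInter fun k => by
      have hr : Measurable fun (z : (i : (A.biUnion T : Finset ι)) → S i) (i : T k) =>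
          z ⟨i, hsub k i⟩ := measurable_pi_lambda _ fun i => measurable_pi_apply _
      exact ((hg k).comp hr) (hsets k (Finset.mem_insert_of_mem k.2))
    have hBA : (fun ω (i : (A.biUnion T : Finset ι)) => f i ω) ⁻¹' B =
        ⋂ k ∈ A, (fun ω => g k (fun i => f i ω)) ⁻¹' sets k := by
      ext ω
      simp [B]
    have hmul := hind.measure_inter_preimage_eq_mul (g a ⁻¹' sets a) B
      (hg a (hsets a (Finset.mem_insert_self a A))) hB
    rw [hBA, ih fun i hi => hsets i (Finset.mem_insert_of_mem hi)] at hmul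
    rw [Finset.prod_insert ha, Finset.set_biInter_insert]
    exact hmul

/-- A second order Taylor bound whose error is absorbed by a larger exponential moment. -/
lemma exp_mul_le {σ s x : ℝ} (hσ : 0 < σ) (hs : |s| ≤ σ) (hx : 0 ≤ x) :
    Real.exp (s * x) ≤ 1 + s * x + 2 * s ^ 2 / σ ^ 2 * Real.exp (2 * σ * x) := by
  have h1 := Complex.norm_exp_sub_sum_le_norm_mul_exp ((s * x : ℝ) : ℂ) 2
  have e : Complex.exp ((s * x : ℝ) : ℂ) - ∑ m ∈ Finset.range 2, ((s * x : ℝ) : ℂ) ^ m / m.factorial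
      = ((Real.exp (s * x) - (1 + s * x) : ℝ) : ℂ) := by
    simp [Finset.sum_range_succ]
  rw [e, Complex.norm_real, Complex.norm_real, Real.norm_eq_abs, Real.norm_eq_abs, sq_abs,
    abs_mul, abs_of_nonneg hx] at h1
  have h2 : Real.exp (|s| * x) ≤ Real.exp (σ * x) := by gcongr
  have h3 : (σ * x) ^ 2 ≤ 2 * Real.exp (σ * x) := by
    have hσx : 0 ≤ σ * x := by positivity
    have := Real.quadratic_le_exp_of_nonneg hσx
    linarith
  have h4 : (s * x) ^ 2 * Real.exp (|s| * x) ≤ 2 * s ^ 2 / σ ^ 2 * Real.exp (2 * σ * x) := by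
    have : (s * x) ^ 2 = s ^ 2 / σ ^ 2 * (σ * x) ^ 2 := by field_simp
    calc (s * x) ^ 2 * Real.exp (|s| * x)
        ≤ (s ^ 2 / σ ^ 2 * (2 * Real.exp (σ * x))) * Real.exp (σ * x) := by
          rw [this]; gcongr
      _ = 2 * s ^ 2 / σ ^ 2 * (Real.exp (σ * x) * Real.exp (σ * x)) := by ring
      _ = _ := by rw [← Real.exp_add]; ring_nf
  linarith [le_abs_self (Real.exp (s * x) - (1 + s * x))]

lemma integrable_exp_mul_of_abs_le [IsFiniteMeasure P] {ξ : Ω → ℝ} (hm : Measurable ξ)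
    (h0 : ∀ ω, 0 ≤ ξ ω) {σ s : ℝ} (hs : |s| ≤ σ)
    (hint : Integrable (fun ω => Real.exp (2 * σ * ξ ω)) P) :
    Integrable (fun ω => Real.exp (s * ξ ω)) P := by
  refine hint.mono' (by fun_prop) (ae_of_all _ fun ω => ?_)
  rw [Real.norm_of_nonneg (Real.exp_pos _).le]
  refine Real.exp_le_exp.mpr (mul_le_mul_of_nonneg_right ?_ (h0 ω))
  linarith [le_abs_self s, abs_nonneg s]

/-- Bernstein's bound on the moment generating function of a nonnegative random variable with an
exponential moment. -/
lemma mgf_le_exp [IsProbabilityMeasure P] {ξ : Ω → ℝ} (hm : Measurable ξ) (h0 : ∀ ω, 0 ≤ ξ ω)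
    {σ K s : ℝ} (hσ : 0 < σ) (hs : |s| ≤ σ)
    (hint : Integrable (fun ω => Real.exp (2 * σ * ξ ω)) P)
    (hK : ∫ ω, Real.exp (2 * σ * ξ ω) ∂P ≤ K) :
    mgf ξ P s ≤ Real.exp (s * P[ξ] + 2 * K / σ ^ 2 * s ^ 2) := by
  have hξ : Integrable ξ P := by
    refine (hint.const_mul (1 / (2 * σ))).mono' (by fun_prop) (ae_of_all _ fun ω => ?_)
    rw [Real.norm_of_nonneg (h0 ω), one_div, ← div_eq_inv_mul, le_div_iff₀ (by positivity)]
    linarith [Real.add_one_le_exp (2 * σ * ξ ω)]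
  have hlin : Integrable (fun ω => 1 + s * ξ ω) P := (integrable_const _).add (hξ.const_mul s)
  calc mgf ξ P s = ∫ ω, Real.exp (s * ξ ω) ∂P := rfl
    _ ≤ ∫ ω, (1 + s * ξ ω + 2 * s ^ 2 / σ ^ 2 * Real.exp (2 * σ * ξ ω)) ∂P := by
        refine integral_mono (integrable_exp_mul_of_abs_le hm h0 hs hint) ?_
          fun ω => exp_mul_le hσ hs (h0 ω)
        exact hlin.add (hint.const_mul _)
    _ = 1 + s * P[ξ] + 2 * s ^ 2 / σ ^ 2 * ∫ ω, Real.exp (2 * σ * ξ ω) ∂P := by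
        rw [integral_add hlin (hint.const_mul _),
          integral_add (integrable_const _) (hξ.const_mul s), integral_const_mul,
          integral_const_mul]
        simp
    _ ≤ 1 + s * P[ξ] + 2 * s ^ 2 / σ ^ 2 * K := by gcongr
    _ = (s * P[ξ] + 2 * K / σ ^ 2 * s ^ 2) + 1 := by ring
    _ ≤ _ := Real.add_one_le_exp _

/-- Chernoff's bound on both tails of a sum of independent nonnegative random variables with a
common mean and a common bound on an exponential moment. -/
lemma measure_abs_sum_sub_ge_le [IsProbabilityMeasure P] {N : ℕ} {ξ : Fin N → Ω → ℝ}
    (hind : iIndepFun ξ P) (hm : ∀ i, Measurable (ξ i)) (h0 : ∀ i ω, 0 ≤ ξ i ω)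
    {σ K s m δ : ℝ} (hσ : 0 < σ) (hs0 : 0 ≤ s) (hs : s ≤ σ)
    (hint : ∀ i, Integrable (fun ω => Real.exp (2 * σ * ξ i ω)) P)
    (hK : ∀ i, ∫ ω, Real.exp (2 * σ * ξ i ω) ∂P ≤ K) (hmean : ∀ i, P[ξ i] = m) :
    P.real {ω | N * δ ≤ |∑ i, ξ i ω - N * m|} ≤
      2 * Real.exp (-(s * (N * δ)) + N * (2 * K / σ ^ 2 * s ^ 2)) := by
  set k := 2 * K / σ ^ 2
  have hmgf : ∀ r : ℝ, |r| ≤ σ →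
      Integrable (fun ω => Real.exp (r * (∑ i, ξ i) ω)) P ∧
      mgf (∑ i, ξ i) P r ≤ Real.exp (r * (N * m) + N * (k * r ^ 2)) := by
    intro r hr
    refine ⟨hind.integrable_exp_mul_sum hm fun i _ =>
      integrable_exp_mul_of_abs_le (hm i) (h0 i) hr (hint i), ?_⟩
    rw [hind.mgf_sum hm]
    calc ∏ i, mgf (ξ i) P r ≤ ∏ _i : Fin N, Real.exp (r * m + k * r ^ 2) := by
          refine Finset.prod_le_prod (fun _ _ => mgf_nonneg) fun i _ => ?_
          have := mgf_le_exp (hm i) (h0 i) hσ hr (hint i) (hK i)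
          rwa [hmean i] at this
      _ = _ := by
          rw [Finset.prod_const, ← Real.exp_nat_mul, Finset.card_univ, Fintype.card_fin]
          ring_nf
  have hup := measure_ge_le_exp_mul_mgf (μ := P) (N * (m + δ)) hs0
    (hmgf s (by rwa [abs_of_nonneg hs0])).1
  have hlo := measure_le_le_exp_mul_mgf (μ := P) (N * (m - δ)) (neg_nonpos.mpr hs0)
    (hmgf (-s) (by rwa [abs_neg, abs_of_nonneg hs0])).1
  have hup' := hup.trans (mul_le_mul_of_nonneg_left
    (hmgf s (by rwa [abs_of_nonneg hs0])).2 (Real.exp_pos _).le)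
  have hlo' := hlo.trans (mul_le_mul_of_nonneg_left
    (hmgf (-s) (by rwa [abs_neg, abs_of_nonneg hs0])).2 (Real.exp_pos _).le)
  rw [← Real.exp_add] at hup' hlo'
  calc _ ≤ P.real ({ω | N * (m + δ) ≤ (∑ i, ξ i) ω} ∪ {ω | (∑ i, ξ i) ω ≤ N * (m - δ)}) := by
        refine measureReal_mono fun ω hω => ?_
        simp only [Set.mem_ofPred_eq, Set.mem_union, Finset.sum_apply] at hω ⊢
        rcases le_abs.mp hω with h | h
        · left; linarith
        · right; linarith
    _ ≤ _ := (measureReal_union_le _ _).trans (add_le_add hup' hlo')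
    _ = _ := by ring_nf

end Concentration

/-! ### Gaussian moments of the link function -/

section GaussianMoments

lemma integrable_exp_sq_gaussianReal :
    Integrable (fun z : ℝ => Real.exp (z ^ 2 / 4)) (gaussianReal 0 1) := by
  rw [gaussianReal_of_var_ne_zero 0 one_ne_zero,
    integrable_withDensity_iff (measurable_gaussianPDF 0 1)
      (ae_of_all _ fun _ => gaussianPDF_lt_top)]
  refine ((integrable_exp_neg_mul_sq (b := 1 / 4) (by norm_num)).const_mul
    (√(2 * Real.pi * 1))⁻¹).congr (ae_of_all _ fun z => ?_)
  simp only [toReal_gaussianPDF, gaussianPDFReal, NNReal.coe_one]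
  rw [mul_left_comm, ← Real.exp_add]
  ring_nf

open scoped RealInnerProductSpace

lemma inner_sub_smul_self {E : Type*} [NormedAddCommGroup E] [InnerProductSpace ℝ E] {β : E}
    (hβ : ‖β‖ = 1) (v : E) : ⟪β, v - ⟪v, β⟫ • β⟫ = 0 := by
  rw [inner_sub_right, inner_smul_right, real_inner_self_eq_norm_sq, hβ, real_inner_comm]
  ring

variable {E : Type*} [NormedAddCommGroup E] [InnerProductSpace ℝ E] [FiniteDimensional ℝ E]
  [MeasurableSpace E] [BorelSpace E]

lemma memLp_inner_stdGaussian (v : E) : MemLp (fun x : E => ⟪x, v⟫) 2 (stdGaussian E) := by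
  have := (IsGaussian.memLp_two_id (μ := stdGaussian E)).const_inner (𝕜 := ℝ) v
  exact this.congr_norm (by fun_prop) (ae_of_all _ fun x => by simp [real_inner_comm])

lemma integral_inner_stdGaussian (v : E) : ∫ x, ⟪x, v⟫ ∂(stdGaussian E) = 0 := by
  have := integral_strongDual_stdGaussian (innerSL ℝ v)
  simpa [real_inner_comm] using this

lemma integral_inner_mul_inner_stdGaussian (v w : E) :
    ∫ x, ⟪x, v⟫ * ⟪x, w⟫ ∂(stdGaussian E) = ⟪v, w⟫ := by
  have h1 := covarianceBilin_apply (μ := stdGaussian E) IsGaussian.memLp_two_id v w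
  rw [covarianceBilin_stdGaussian] at h1
  simp only [id, integral_id_stdGaussian, sub_zero] at h1
  simp_rw [real_inner_comm _ v, real_inner_comm _ w] at h1
  exact h1.symm

lemma map_inner_stdGaussian {v : E} (hv : ‖v‖ = 1) :
    (stdGaussian E).map (fun x => ⟪x, v⟫) = gaussianReal 0 1 := by
  have h : HasGaussianLaw (fun x : E => ⟪x, v⟫) (stdGaussian E) := by
    have := (IsGaussian.hasGaussianLaw_id (μ := stdGaussian E)).map_fun (innerSL ℝ v)
    simpa [real_inner_comm] using this
  rw [h.map_eq_gaussianReal, integral_inner_stdGaussian,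
    variance_of_integral_eq_zero (by fun_prop) (integral_inner_stdGaussian v)]
  simp only [pow_two, integral_inner_mul_inner_stdGaussian, real_inner_self_eq_norm_sq, hv]
  simp

lemma indepFun_inner_stdGaussian {v w : E} (h : ⟪v, w⟫ = 0) :
    IndepFun (fun x : E => ⟪x, v⟫) (fun x : E => ⟪x, w⟫) (stdGaussian E) := by
  apply HasGaussianLaw.indepFun_of_covariance_eq_zero
  · have := (IsGaussian.hasGaussianLaw_id (μ := stdGaussian E)).map_fun
      ((innerSL ℝ v).prod (innerSL ℝ w))
    simpa [real_inner_comm] using this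
  · rw [covariance_eq_sub (memLp_inner_stdGaussian v) (memLp_inner_stdGaussian w)]
    simp only [Pi.mul_apply, integral_inner_mul_inner_stdGaussian, integral_inner_stdGaussian, h]
    simp

variable {f : ℝ → ℝ} {β : E}

lemma measurable_link (hf : Measurable f) : Measurable fun x : E => f ⟪x, β⟫ :=
  hf.comp (by fun_prop)

lemma integral_comp_inner_stdGaussian (hβ : ‖β‖ = 1) {g : ℝ → ℝ} (hg : Measurable g) :
    ∫ x, g ⟪x, β⟫ ∂(stdGaussian E) = ∫ z, g z ∂(gaussianReal 0 1) := by
  rw [← map_inner_stdGaussian hβ, integral_map (by fun_prop) hg.aestronglyMeasurable]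

lemma integrable_link_mul (hf : Measurable f) (hb : ∀ z, f z ∈ Set.Icc (-1 : ℝ) 1) {g : E → ℝ}
    (hg : Integrable g (stdGaussian E)) :
    Integrable (fun x => f ⟪x, β⟫ * g x) (stdGaussian E) :=
  hg.bdd_mul (c := 1) (measurable_link hf).aestronglyMeasurable (ae_of_all _ fun _ => abs_le.mpr (hb _))

lemma integral_link_stdGaussian (hf : Measurable f) (hβ : ‖β‖ = 1) :
    ∫ x, f ⟪x, β⟫ ∂(stdGaussian E) = mu f 0 := by
  rw [integral_comp_inner_stdGaussian hβ hf]
  simp [mu]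

lemma integrable_inner_mul_inner_stdGaussian (v w : E) :
    Integrable (fun x : E => ⟪x, v⟫ * ⟪x, w⟫) (stdGaussian E) :=
  (memLp_inner_stdGaussian v).integrable_mul (memLp_inner_stdGaussian w)

lemma integrable_inner_stdGaussian (v : E) : Integrable (fun x : E => ⟪x, v⟫) (stdGaussian E) :=
  (memLp_inner_stdGaussian v).integrable one_le_two

lemma integral_link_mul_inner_stdGaussian (hf : Measurable f)
    (hb : ∀ z, f z ∈ Set.Icc (-1 : ℝ) 1) (hβ : ‖β‖ = 1) (v : E) :
    ∫ x, f ⟪x, β⟫ * ⟪x, v⟫ ∂(stdGaussian E) = mu f 1 * ⟪v, β⟫ := by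
  set w := v - ⟪v, β⟫ • β with hw
  have hdec : ∀ x : E, f ⟪x, β⟫ * ⟪x, v⟫ =
      ⟪v, β⟫ * (f ⟪x, β⟫ * ⟪x, β⟫) + f ⟪x, β⟫ * ⟪x, w⟫ := by
    intro x
    have : ⟪x, v⟫ = ⟪v, β⟫ * ⟪x, β⟫ + ⟪x, w⟫ := by
      rw [hw, inner_sub_right, inner_smul_right]; ring
    rw [this]; ring
  have hI := indepFun_inner_stdGaussian (inner_sub_smul_self hβ v)
  have h1 : ∫ x, f ⟪x, β⟫ * ⟪x, w⟫ ∂(stdGaussian E) = 0 := by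
    have hI' : IndepFun (fun x : E => f ⟪x, β⟫) (fun x : E => ⟪x, w⟫) (stdGaussian E) :=
      hI.comp hf measurable_id
    rw [hI'.integral_fun_mul_eq_mul_integral
      (measurable_link hf).aestronglyMeasurable (by fun_prop),
      integral_inner_stdGaussian, mul_zero]
  have h2 : ∫ x, f ⟪x, β⟫ * ⟪x, β⟫ ∂(stdGaussian E) = mu f 1 := by
    rw [integral_comp_inner_stdGaussian hβ (g := fun z => f z * z) (by fun_prop)]
    simp [mu]
  simp_rw [hdec]
  rw [integral_add, integral_const_mul, h1, h2]
  · ring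
  · exact (integrable_link_mul hf hb (integrable_inner_stdGaussian β)).const_mul _
  · exact integrable_link_mul hf hb (integrable_inner_stdGaussian w)

lemma integral_link_mul_inner_sq_stdGaussian (hf : Measurable f)
    (hb : ∀ z, f z ∈ Set.Icc (-1 : ℝ) 1) (hβ : ‖β‖ = 1) (v : E) :
    ∫ x, f ⟪x, β⟫ * ⟪x, v⟫ ^ 2 ∂(stdGaussian E) =
      mu f 2 * ⟪v, β⟫ ^ 2 + mu f 0 * (‖v‖ ^ 2 - ⟪v, β⟫ ^ 2) := by
  set w := v - ⟪v, β⟫ • β with hw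
  have hβw : ⟪β, w⟫ = 0 := inner_sub_smul_self hβ v
  have hwn : ⟪w, w⟫ = ‖v‖ ^ 2 - ⟪v, β⟫ ^ 2 := by
    rw [hw]
    simp only [inner_sub_left, inner_sub_right, inner_smul_left, inner_smul_right, conj_trivial,
      real_inner_self_eq_norm_sq, hβ, real_inner_comm v β]
    ring
  have hdec : ∀ x : E, f ⟪x, β⟫ * ⟪x, v⟫ ^ 2 =
      ⟪v, β⟫ ^ 2 * (f ⟪x, β⟫ * (⟪x, β⟫ * ⟪x, β⟫))
        + 2 * ⟪v, β⟫ * (f ⟪x, β⟫ * (⟪x, β⟫ * ⟪x, w⟫)) + f ⟪x, β⟫ * (⟪x, w⟫ * ⟪x, w⟫) := by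
    intro x
    have : ⟪x, v⟫ = ⟪v, β⟫ * ⟪x, β⟫ + ⟪x, w⟫ := by
      rw [hw, inner_sub_right, inner_smul_right]; ring
    rw [this]; ring
  have hI := indepFun_inner_stdGaussian hβw
  have h1 : ∫ x, f ⟪x, β⟫ * (⟪x, β⟫ * ⟪x, w⟫) ∂(stdGaussian E) = 0 := by
    have hI' : IndepFun (fun x : E => f ⟪x, β⟫ * ⟪x, β⟫) (fun x : E => ⟪x, w⟫) (stdGaussian E) :=
      hI.comp (φ := fun z => f z * z) (by fun_prop) measurable_id
    simp_rw [← mul_assoc]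
    rw [hI'.integral_fun_mul_eq_mul_integral
      ((measurable_link hf).mul (by fun_prop)).aestronglyMeasurable (by fun_prop),
      integral_inner_stdGaussian, mul_zero]
  have h2 : ∫ x, f ⟪x, β⟫ * (⟪x, w⟫ * ⟪x, w⟫) ∂(stdGaussian E) =
      mu f 0 * (‖v‖ ^ 2 - ⟪v, β⟫ ^ 2) := by
    have hI' : IndepFun (fun x : E => f ⟪x, β⟫) (fun x : E => ⟪x, w⟫ * ⟪x, w⟫) (stdGaussian E) :=
      hI.comp (ψ := fun z => z * z) hf (by fun_prop)
    rw [hI'.integral_fun_mul_eq_mul_integral (measurable_link hf).aestronglyMeasurable (by fun_prop),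
      integral_inner_mul_inner_stdGaussian, integral_link_stdGaussian hf hβ, hwn]
  have h3 : ∫ x, f ⟪x, β⟫ * (⟪x, β⟫ * ⟪x, β⟫) ∂(stdGaussian E) = mu f 2 := by
    rw [integral_comp_inner_stdGaussian hβ (g := fun z => f z * (z * z)) (by fun_prop)]
    simp [mu, pow_two]
  have i1 := (integrable_link_mul (β := β) hf hb
    (integrable_inner_mul_inner_stdGaussian β β)).const_mul (⟪v, β⟫ ^ 2)
  have i2 := (integrable_link_mul (β := β) hf hb
    (integrable_inner_mul_inner_stdGaussian β w)).const_mul (2 * ⟪v, β⟫)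
  have i3 := integrable_link_mul (β := β) hf hb (integrable_inner_mul_inner_stdGaussian w w)
  have i12 : Integrable (fun x => ⟪v, β⟫ ^ 2 * (f ⟪x, β⟫ * (⟪x, β⟫ * ⟪x, β⟫))
      + 2 * ⟪v, β⟫ * (f ⟪x, β⟫ * (⟪x, β⟫ * ⟪x, w⟫))) (stdGaussian E) := i1.add i2
  simp_rw [hdec]
  rw [integral_add i12 i3, integral_add i1 i2, integral_const_mul, integral_const_mul,
    h1, h2, h3]
  ring

end GaussianMoments

/-! ### A single pair of observations -/

section Model

open scoped RealInnerProductSpace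

variable {Ω : Type*} [MeasurableSpace Ω] {P : Measure Ω} {p : ℕ}
  {f : ℝ → ℝ} {β : EuclideanSpace ℝ (Fin p)}

lemma integrable_response_mul {Y : Ω → ℝ} {X : Ω → EuclideanSpace ℝ (Fin p)}
    (h : FollowsModel P f β Y X) (hX : P.map X = stdGaussian (EuclideanSpace ℝ (Fin p)))
    {g : EuclideanSpace ℝ (Fin p) → ℝ} (hg : Integrable g (stdGaussian _)) :
    Integrable (fun ω => Y ω * g (X ω)) P := by
  rw [← hX] at hg
  refine (hg.comp_measurable h.measurable_X).bdd_mul (c := 1)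
    h.measurable_Y.aestronglyMeasurable ?_
  filter_upwards [h.binary] with ω hω
  rcases hω with hω | hω <;> simp [hω]

/-- In expectations against functions of `X`, the response `Y` may be replaced by its conditional
mean `f ⟪X, β⟫`. -/
lemma integral_response_mul [IsProbabilityMeasure P] {Y : Ω → ℝ} {X : Ω → EuclideanSpace ℝ (Fin p)}
    (h : FollowsModel P f β Y X) (hX : P.map X = stdGaussian (EuclideanSpace ℝ (Fin p)))
    (hf : Measurable f) (hb : ∀ z, f z ∈ Set.Icc (-1 : ℝ) 1)
    {g : EuclideanSpace ℝ (Fin p) → ℝ} (hgm : Measurable g) (hg : Integrable g (stdGaussian _)) :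
    ∫ ω, Y ω * g (X ω) ∂P = ∫ x, f ⟪x, β⟫ * g x ∂(stdGaussian _) := by
  have hle : MeasurableSpace.comap X inferInstance ≤ ‹MeasurableSpace Ω› :=
    h.measurable_X.comap_le
  set S := {ω | Y ω = 1} with hS
  have hSm : MeasurableSet S := h.measurable_Y (measurableSet_singleton 1)
  have hgX : Integrable (fun ω => g (X ω)) P := by
    rw [← hX] at hg; exact hg.comp_measurable h.measurable_X
  have hfgX : Integrable (fun ω => f ⟪X ω, β⟫ * g (X ω)) P := by
    have := integrable_link_mul (β := β) hf hb hg
    rw [← hX] at this; exact this.comp_measurable h.measurable_X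
  have hgsm : StronglyMeasurable[MeasurableSpace.comap X inferInstance] fun ω => g (X ω) :=
    (hgm.comp (comap_measurable X)).stronglyMeasurable
  have hind : Integrable (S.indicator fun _ => (1 : ℝ)) P :=
    (integrable_const 1).indicator hSm
  have hindg : Integrable ((S.indicator fun _ => (1 : ℝ)) * fun ω => g (X ω)) P := by
    refine hgX.bdd_mul (c := 1) hind.aestronglyMeasurable (ae_of_all _ fun ω => ?_)
    by_cases hω : ω ∈ S <;> simp [hω]
  have hpull := condExp_mul_of_stronglyMeasurable_right (μ := P) hgsm hindg hind
  have hkey : ∫ ω, (S.indicator (fun _ => (1 : ℝ)) ω) * g (X ω) ∂P =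
      ∫ ω, (1 / 2 * f ⟪X ω, β⟫ + 1 / 2) * g (X ω) ∂P := by
    calc _ = ∫ ω, ((S.indicator fun _ => (1 : ℝ)) * fun ω => g (X ω)) ω ∂P := rfl
      _ = ∫ ω, (P[(S.indicator fun _ => (1 : ℝ)) * fun ω => g (X ω) |
          MeasurableSpace.comap X inferInstance]) ω ∂P :=
        (integral_condExp hle).symm
      _ = _ := by
        refine integral_congr_ae ?_
        filter_upwards [hpull, h.cond_prob] with ω h1 h2
        rw [h1, Pi.mul_apply]
        congr 1
  have e1 : ∫ ω, Y ω * g (X ω) ∂P =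
      ∫ ω, (2 * ((S.indicator (fun _ => (1 : ℝ)) ω) * g (X ω)) - g (X ω)) ∂P := by
    refine integral_congr_ae ?_
    filter_upwards [h.binary] with ω hω
    rcases hω with hω | hω
    · have : ω ∉ S := by simp only [hS, Set.mem_ofPred_eq, hω]; norm_num
      simp [this, hω]
    · have : ω ∈ S := hω
      simp only [Set.indicator_of_mem this, hω]; ring
  have e2 : ∫ ω, (1 / 2 * f ⟪X ω, β⟫ + 1 / 2) * g (X ω) ∂P =
      1 / 2 * ∫ ω, f ⟪X ω, β⟫ * g (X ω) ∂P + 1 / 2 * ∫ ω, g (X ω) ∂P := by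
    rw [← integral_const_mul, ← integral_const_mul, ← integral_add (hfgX.const_mul _)
      (hgX.const_mul _)]
    congr 1; ext ω; ring
  have hindg' : Integrable (fun ω => 2 * ((S.indicator (fun _ => (1 : ℝ)) ω) * g (X ω))) P :=
    Integrable.const_mul hindg 2
  have hfg : Measurable fun x => f ⟪x, β⟫ * g x := (measurable_link hf).mul hgm
  rw [e1, integral_sub hindg' hgX, integral_const_mul, hkey, e2, ← hX,
    integral_map h.measurable_X.aemeasurable hfg.aestronglyMeasurable]
  ring

variable {Y₁ Y₂ : Ω → ℝ} {X₁ X₂ : Ω → EuclideanSpace ℝ (Fin p)}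

/-- The population version of the second moment matrix is the spiked matrix
`4 (1 - μ₀²) • 1 + 4 φ(f) • β βᵀ`. The responses being signs, `(Y₂ - Y₁)² = 2 - 2 Y₁ Y₂`. -/
lemma integral_pair [IsProbabilityMeasure P] (h₁ : FollowsModel P f β Y₁ X₁) (h₂ : FollowsModel P f β Y₂ X₂)
    (hX₁ : P.map X₁ = stdGaussian (EuclideanSpace ℝ (Fin p)))
    (hX₂ : P.map X₂ = stdGaussian (EuclideanSpace ℝ (Fin p)))
    (hind : IndepFun (fun ω => (Y₁ ω, X₁ ω)) (fun ω => (Y₂ ω, X₂ ω)) P)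
    (hf : Measurable f) (hb : ∀ z, f z ∈ Set.Icc (-1 : ℝ) 1) (hβ : ‖β‖ = 1)
    (v : EuclideanSpace ℝ (Fin p)) :
    ∫ ω, (Y₂ ω - Y₁ ω) ^ 2 * ⟪X₂ ω - X₁ ω, v⟫ ^ 2 ∂P =
      4 * (1 - mu f 0 ^ 2) * ‖v‖ ^ 2 + 4 * phi f * ⟪v, β⟫ ^ 2 := by
  have hY₁ := h₁.measurable_Y
  have hY₂ := h₂.measurable_Y
  have hXm₁ := h₁.measurable_X
  have hXm₂ := h₂.measurable_X
  -- products of a function of the first and a function of the second observation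
  have hprod : ∀ {G H : ℝ × EuclideanSpace ℝ (Fin p) → ℝ} {a b : ℝ}, Measurable G → Measurable H →
      (Integrable (fun ω => G (Y₁ ω, X₁ ω)) P ∧ ∫ ω, G (Y₁ ω, X₁ ω) ∂P = a) →
      (Integrable (fun ω => H (Y₂ ω, X₂ ω)) P ∧ ∫ ω, H (Y₂ ω, X₂ ω) ∂P = b) → ∀ c : ℝ,
      (Integrable (fun ω => c * (G (Y₁ ω, X₁ ω) * H (Y₂ ω, X₂ ω))) P ∧
        ∫ ω, c * (G (Y₁ ω, X₁ ω) * H (Y₂ ω, X₂ ω)) ∂P = c * (a * b)) := by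
    intro G H a b hG hH h1 h2 c
    have hi : IndepFun (fun ω => G (Y₁ ω, X₁ ω)) (fun ω => H (Y₂ ω, X₂ ω)) P := hind.comp hG hH
    refine ⟨(hi.integrable_mul h1.1 h2.1).const_mul c, ?_⟩
    rw [integral_const_mul, hi.integral_fun_mul_eq_mul_integral h1.1.aestronglyMeasurable
      h2.1.aestronglyMeasurable, h1.2, h2.2]
  have hadd : ∀ {F G : Ω → ℝ} {a b : ℝ}, (Integrable F P ∧ ∫ ω, F ω ∂P = a) →
      (Integrable G P ∧ ∫ ω, G ω ∂P = b) →
      (Integrable (fun ω => F ω + G ω) P ∧ ∫ ω, F ω + G ω ∂P = a + b) := by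
    intro F G a b h1 h2
    exact ⟨h1.1.add h2.1, by rw [integral_add h1.1 h2.1, h1.2, h2.2]⟩
  -- the moments of a single observation
  have hmom : ∀ {Y : Ω → ℝ} {X : Ω → EuclideanSpace ℝ (Fin p)}, FollowsModel P f β Y X →
      P.map X = stdGaussian (EuclideanSpace ℝ (Fin p)) →
      (Integrable (fun ω => ⟪X ω, v⟫) P ∧ ∫ ω, ⟪X ω, v⟫ ∂P = 0) ∧
      (Integrable (fun ω => ⟪X ω, v⟫ ^ 2) P ∧ ∫ ω, ⟪X ω, v⟫ ^ 2 ∂P = ‖v‖ ^ 2) ∧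
      (Integrable (fun ω => Y ω) P ∧ ∫ ω, Y ω ∂P = mu f 0) ∧
      (Integrable (fun ω => Y ω * ⟪X ω, v⟫) P ∧ ∫ ω, Y ω * ⟪X ω, v⟫ ∂P = mu f 1 * ⟪v, β⟫) ∧
      (Integrable (fun ω => Y ω * ⟪X ω, v⟫ ^ 2) P ∧ ∫ ω, Y ω * ⟪X ω, v⟫ ^ 2 ∂P =
        mu f 2 * ⟪v, β⟫ ^ 2 + mu f 0 * (‖v‖ ^ 2 - ⟪v, β⟫ ^ 2)) := by
    intro Y X h hX
    have i1 := integrable_inner_stdGaussian v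
    have i2 : Integrable (fun x : EuclideanSpace ℝ (Fin p) => ⟪x, v⟫ ^ 2) (stdGaussian _) := by
      simpa only [pow_two] using integrable_inner_mul_inner_stdGaussian v v
    have hm1 : Measurable fun x : EuclideanSpace ℝ (Fin p) => ⟪x, v⟫ := by fun_prop
    have hm2 : Measurable fun x : EuclideanSpace ℝ (Fin p) => ⟪x, v⟫ ^ 2 := by fun_prop
    have i0 : Integrable (fun _ : EuclideanSpace ℝ (Fin p) => (1 : ℝ)) (stdGaussian _) :=
      integrable_const 1
    refine ⟨⟨?_, ?_⟩, ⟨?_, ?_⟩, ⟨?_, ?_⟩, ⟨?_, ?_⟩, ⟨?_, ?_⟩⟩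
    · rw [← hX] at i1; exact i1.comp_measurable h.measurable_X
    · rw [← integral_inner_stdGaussian v, ← hX,
        integral_map h.measurable_X.aemeasurable hm1.aestronglyMeasurable]
    · rw [← hX] at i2; exact i2.comp_measurable h.measurable_X
    · rw [← real_inner_self_eq_norm_sq, ← integral_inner_mul_inner_stdGaussian, ← hX,
        integral_map h.measurable_X.aemeasurable (by fun_prop)]
      simp only [pow_two]
    · simpa using integrable_response_mul h hX i0
    · have := integral_response_mul h hX hf hb measurable_const i0
      simpa [integral_link_stdGaussian hf hβ] using this
    · exact integrable_response_mul h hX i1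
    · rw [integral_response_mul h hX hf hb hm1 i1, integral_link_mul_inner_stdGaussian hf hb hβ]
    · exact integrable_response_mul h hX i2
    · rw [integral_response_mul h hX hf hb hm2 i2,
        integral_link_mul_inner_sq_stdGaussian hf hb hβ]
  obtain ⟨a1, a2, a3, a4, a5⟩ := hmom h₁ hX₁
  obtain ⟨b1, b2, b3, b4, b5⟩ := hmom h₂ hX₂
  have one : Integrable (fun _ : Ω => (1 : ℝ)) P ∧ ∫ _ω, (1 : ℝ) ∂P = 1 :=
    ⟨integrable_const 1, by simp⟩
  have g0 : Measurable fun _ : ℝ × EuclideanSpace ℝ (Fin p) => (1 : ℝ) := measurable_const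
  have g1 : Measurable fun z : ℝ × EuclideanSpace ℝ (Fin p) => ⟪z.2, v⟫ := by fun_prop
  have g2 : Measurable fun z : ℝ × EuclideanSpace ℝ (Fin p) => ⟪z.2, v⟫ ^ 2 := by fun_prop
  have g3 : Measurable fun z : ℝ × EuclideanSpace ℝ (Fin p) => z.1 := measurable_fst
  have g4 : Measurable fun z : ℝ × EuclideanSpace ℝ (Fin p) => z.1 * ⟪z.2, v⟫ := by fun_prop
  have g5 : Measurable fun z : ℝ × EuclideanSpace ℝ (Fin p) => z.1 * ⟪z.2, v⟫ ^ 2 := by fun_prop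
  have total := hadd (hadd (hadd (hadd (hadd (hprod g0 g2 one b2 2) (hprod g1 g1 a1 b1 (-4)))
    (hprod g2 g0 a2 one 2)) (hprod g3 g5 a3 b5 (-2))) (hprod g4 g4 a4 b4 4))
    (hprod g5 g3 a5 b3 (-2))
  rw [integral_congr_ae (g := _) ?_, total.2]
  · unfold phi; ring
  · filter_upwards [h₁.binary, h₂.binary] with ω h1 h2
    rw [inner_sub_left]
    rcases h1 with h1 | h1 <;> rcases h2 with h2 | h2 <;> rw [h1, h2] <;> ring

/-- The terms of the quadratic form of the second moment matrix have an exponential moment that is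
bounded by an absolute constant. -/
lemma integrable_exp_pair (h₁ : FollowsModel P f β Y₁ X₁) (h₂ : FollowsModel P f β Y₂ X₂)
    (hX₁ : P.map X₁ = stdGaussian (EuclideanSpace ℝ (Fin p)))
    (hX₂ : P.map X₂ = stdGaussian (EuclideanSpace ℝ (Fin p)))
    {v : EuclideanSpace ℝ (Fin p)} (hv : ‖v‖ = 1) :
    Integrable (fun ω => Real.exp (2 * (1 / 128) *
      ((Y₂ ω - Y₁ ω) ^ 2 * ⟪X₂ ω - X₁ ω, v⟫ ^ 2))) P ∧
    ∫ ω, Real.exp (2 * (1 / 128) * ((Y₂ ω - Y₁ ω) ^ 2 * ⟪X₂ ω - X₁ ω, v⟫ ^ 2)) ∂P ≤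
      ∫ z, Real.exp (z ^ 2 / 4) ∂(gaussianReal 0 1) := by
  have hY₁ := h₁.measurable_Y
  have hY₂ := h₂.measurable_Y
  have hXm₁ := h₁.measurable_X
  have hXm₂ := h₂.measurable_X
  have hg : Measurable fun z : ℝ => Real.exp (z ^ 2 / 4) := by fun_prop
  have hmv : Measurable fun x : EuclideanSpace ℝ (Fin p) => ⟪x, v⟫ := by fun_prop
  have hone : ∀ {X : Ω → EuclideanSpace ℝ (Fin p)}, Measurable X →
      P.map X = stdGaussian (EuclideanSpace ℝ (Fin p)) →
      Integrable (fun ω => Real.exp (⟪X ω, v⟫ ^ 2 / 4)) P ∧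
      ∫ ω, Real.exp (⟪X ω, v⟫ ^ 2 / 4) ∂P = ∫ z, Real.exp (z ^ 2 / 4) ∂(gaussianReal 0 1) := by
    intro X hXm hX
    have hlaw : P.map (fun ω => ⟪X ω, v⟫) = gaussianReal 0 1 := by
      rw [← map_inner_stdGaussian hv, ← hX, Measure.map_map hmv hXm]; rfl
    have hi := integrable_exp_sq_gaussianReal
    rw [← hlaw] at hi ⊢
    exact ⟨hi.comp_measurable (hmv.comp hXm),
      (integral_map (hmv.comp hXm).aemeasurable hg.aestronglyMeasurable).symm⟩
  obtain ⟨i1, e1⟩ := hone hXm₁ hX₁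
  obtain ⟨i2, e2⟩ := hone hXm₂ hX₂
  have hbound : ∀ᵐ ω ∂P, Real.exp (2 * (1 / 128) *
      ((Y₂ ω - Y₁ ω) ^ 2 * ⟪X₂ ω - X₁ ω, v⟫ ^ 2)) ≤
      1 / 2 * Real.exp (⟪X₁ ω, v⟫ ^ 2 / 4) + 1 / 2 * Real.exp (⟪X₂ ω, v⟫ ^ 2 / 4) := by
    filter_upwards [h₁.binary, h₂.binary] with ω h1 h2
    rw [inner_sub_left]
    set s := ⟪X₁ ω, v⟫
    set r := ⟪X₂ ω, v⟫
    have hy : (Y₂ ω - Y₁ ω) ^ 2 ≤ 4 := by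
      rcases h1 with h1 | h1 <;> rcases h2 with h2 | h2 <;> rw [h1, h2] <;> norm_num
    have hle : 2 * (1 / 128) * ((Y₂ ω - Y₁ ω) ^ 2 * (r - s) ^ 2) ≤ s ^ 2 / 8 + r ^ 2 / 8 := by
      have := mul_le_mul_of_nonneg_right hy (sq_nonneg (r - s))
      nlinarith [sq_nonneg (r + s)]
    refine (Real.exp_le_exp.mpr hle).trans ?_
    rw [Real.exp_add, show s ^ 2 / 4 = s ^ 2 / 8 + s ^ 2 / 8 by ring,
      show r ^ 2 / 4 = r ^ 2 / 8 + r ^ 2 / 8 by ring, Real.exp_add, Real.exp_add]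
    nlinarith [sq_nonneg (Real.exp (s ^ 2 / 8) - Real.exp (r ^ 2 / 8))]
  have hsum := (i1.const_mul (1 / 2)).add (i2.const_mul (1 / 2))
  have hint : Integrable (fun ω => Real.exp (2 * (1 / 128) *
      ((Y₂ ω - Y₁ ω) ^ 2 * ⟪X₂ ω - X₁ ω, v⟫ ^ 2))) P := by
    refine hsum.mono' (by fun_prop) ?_
    filter_upwards [hbound] with ω hω
    rwa [Real.norm_of_nonneg (Real.exp_pos _).le]
  refine ⟨hint, (integral_mono_ae hint hsum hbound).trans (le_of_eq ?_)⟩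
  simp only [Pi.add_apply]
  rw [integral_add (i1.const_mul _) (i2.const_mul _), integral_const_mul, integral_const_mul,
    e1, e2]
  ring

end Model

section SecondMoment

open scoped RealInnerProductSpace

lemma toEuclideanLin_vecMulVec_apply {p : ℕ} (d u : EuclideanSpace ℝ (Fin p)) :
    Matrix.toEuclideanLin (Matrix.vecMulVec (fun j => d j) (fun j => d j)) u = ⟪d, u⟫ • d := by
  ext j
  simp [Matrix.toLpLin_apply, Matrix.mulVec, Matrix.vecMulVec, dotProduct, PiLp.inner_apply,
    Finset.mul_sum, mul_comm, mul_assoc]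

lemma inner_secondMoment_apply {p n : ℕ} (y : Fin n → ℝ) (x : Fin n → EuclideanSpace ℝ (Fin p))
    (u w : EuclideanSpace ℝ (Fin p)) :
    ⟪Matrix.toEuclideanLin (secondMoment y x) u, w⟫ =
      2 / n * ∑ i : Fin (n / 2), (y ⟨2 * i + 1, by omega⟩ - y ⟨2 * i, by omega⟩) ^ 2 *
        (⟪x ⟨2 * i + 1, by omega⟩ - x ⟨2 * i, by omega⟩, u⟫ *
          ⟪x ⟨2 * i + 1, by omega⟩ - x ⟨2 * i, by omega⟩, w⟫) := by
  have key := fun i : Fin (n / 2) => toEuclideanLin_vecMulVec_apply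
    (x ⟨2 * i + 1, by omega⟩ - x ⟨2 * i, by omega⟩) u
  simp only [PiLp.sub_apply] at key
  simp only [secondMoment, map_smul, map_sum, LinearMap.smul_apply, LinearMap.sum_apply, key,
    inner_smul_left, sum_inner, conj_trivial]

lemma isSymmetric_secondMoment {p n : ℕ} (y : Fin n → ℝ) (x : Fin n → EuclideanSpace ℝ (Fin p)) :
    (Matrix.toEuclideanLin (secondMoment y x)).IsSymmetric := by
  intro u w
  rw [real_inner_comm _ u, inner_secondMoment_apply, inner_secondMoment_apply]
  congr 1
  exact Finset.sum_congr rfl fun i _ => by ring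

lemma inner_secondMoment_self_nonneg {p n : ℕ} (y : Fin n → ℝ)
    (x : Fin n → EuclideanSpace ℝ (Fin p)) (u : EuclideanSpace ℝ (Fin p)) :
    0 ≤ ⟪Matrix.toEuclideanLin (secondMoment y x) u, u⟫ := by
  rw [inner_secondMoment_apply]
  refine mul_nonneg (by positivity) (Finset.sum_nonneg fun i _ => ?_)
  exact mul_nonneg (sq_nonneg _) (mul_self_nonneg _)

end SecondMoment

/-! ### Uniform concentration of the second moment matrix -/

section Event

open scoped RealInnerProductSpace

variable {Ω : Type*} [MeasurableSpace Ω] {P : Measure Ω} {p n : ℕ} {f : ℝ → ℝ}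
  {β : EuclideanSpace ℝ (Fin p)} {y : Fin n → Ω → ℝ} {x : Fin n → Ω → EuclideanSpace ℝ (Fin p)}

lemma iIndepFun_pairs (h : IsSample P f β y x) (v : EuclideanSpace ℝ (Fin p)) :
    iIndepFun (fun (i : Fin (n / 2)) ω =>
      (y ⟨2 * i + 1, by omega⟩ ω - y ⟨2 * i, by omega⟩ ω) ^ 2 *
        ⟪x ⟨2 * i + 1, by omega⟩ ω - x ⟨2 * i, by omega⟩ ω, v⟫ ^ 2) P := by
  let T : Fin (n / 2) → Finset (Fin n) := fun i => {⟨2 * i, by omega⟩, ⟨2 * i + 1, by omega⟩}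
  have hT : ∀ j k, j ≠ k → Disjoint (T j) (T k) := by
    intro j k hjk
    have hne : (j : ℕ) ≠ k := fun e => hjk (Fin.ext e)
    rw [Finset.disjoint_left]
    intro a ha hb
    simp only [T, Finset.mem_insert, Finset.mem_singleton, Fin.ext_iff] at ha hb
    omega
  let g : (i : Fin (n / 2)) → (T i → ℝ × EuclideanSpace ℝ (Fin p)) → ℝ := fun i z =>
    ((z ⟨⟨2 * i + 1, by omega⟩, by simp [T]⟩).1 - (z ⟨⟨2 * i, by omega⟩, by simp [T]⟩).1) ^ 2 *
      ⟪(z ⟨⟨2 * i + 1, by omega⟩, by simp [T]⟩).2 - (z ⟨⟨2 * i, by omega⟩, by simp [T]⟩).2, v⟫ ^ 2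
  have hg : ∀ i, Measurable (g i) := by
    intro i
    have m1 := measurable_pi_apply (X := fun _ : T i => ℝ × EuclideanSpace ℝ (Fin p))
      ⟨⟨2 * i + 1, by omega⟩, by simp [T]⟩
    have m0 := measurable_pi_apply (X := fun _ : T i => ℝ × EuclideanSpace ℝ (Fin p))
      ⟨⟨2 * i, by omega⟩, by simp [T]⟩
    exact ((m1.fst.sub m0.fst).pow_const 2).mul
      (((m1.snd.sub m0.snd).inner measurable_const).pow_const 2)
  exact iIndepFun_comp_blocks h.indep
    (fun i => (h.model i).measurable_Y.prodMk (h.model i).measurable_X) T hT hg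

/-- For one unit vector, the quadratic form of the second moment matrix concentrates. -/
lemma measure_quadratic_deviation_le [IsProbabilityMeasure P] (h : IsSample P f β y x)
    (hf : Measurable f) (hb : ∀ z, f z ∈ Set.Icc (-1 : ℝ) 1) (hβ : ‖β‖ = 1)
    {v : EuclideanSpace ℝ (Fin p)} (hv : ‖v‖ = 1) {s δ : ℝ} (hs0 : 0 ≤ s) (hs : s ≤ 1 / 128) :
    P.real {ω | (n / 2 : ℕ) * δ ≤ |∑ i : Fin (n / 2),
      (y ⟨2 * i + 1, by omega⟩ ω - y ⟨2 * i, by omega⟩ ω) ^ 2 *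
        ⟪x ⟨2 * i + 1, by omega⟩ ω - x ⟨2 * i, by omega⟩ ω, v⟫ ^ 2
        - (n / 2 : ℕ) * (4 * (1 - mu f 0 ^ 2) * ‖v‖ ^ 2 + 4 * phi f * ⟪v, β⟫ ^ 2)|} ≤
      2 * Real.exp (-(s * ((n / 2 : ℕ) * δ)) + (n / 2 : ℕ) *
        (2 * (∫ z, Real.exp (z ^ 2 / 4) ∂(gaussianReal 0 1)) / (1 / 128) ^ 2 * s ^ 2)) := by
  have hexp := fun i : Fin (n / 2) => integrable_exp_pair (h.model ⟨2 * i, by omega⟩)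
    (h.model ⟨2 * i + 1, by omega⟩) (h.gaussian _) (h.gaussian _) hv
  refine measure_abs_sum_sub_ge_le (iIndepFun_pairs h v) ?_ ?_ (by norm_num) hs0 hs
    (fun i => (hexp i).1) (fun i => (hexp i).2) ?_
  · intro i
    exact (((h.model _).measurable_Y.sub (h.model _).measurable_Y).pow_const 2).mul
      ((((h.model _).measurable_X.sub (h.model _).measurable_X).inner
        measurable_const).pow_const 2)
  · intro i ω
    positivity
  · intro i
    refine integral_pair (h.model _) (h.model _) (h.gaussian _) (h.gaussian _)
      (h.indep.indepFun ?_) hf hb hβ v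
    simp [Fin.ext_iff]

/-- The absolute constant in the deviation bound for the second moment matrix. The factor `40` is
lost in passing from a net to the sphere, `1 / 128` is the range of the Chernoff parameter, and
`√2` appears because there are `n / 2` pairs. -/
noncomputable def deviationConst : ℝ :=
  40 * (2 * (∫ z, Real.exp (z ^ 2 / 4) ∂(gaussianReal 0 1)) / (1 / 128) ^ 2 + 3) * √2

lemma deviationConst_pos : 0 < deviationConst := by
  have : 0 ≤ ∫ z, Real.exp (z ^ 2 / 4) ∂(gaussianReal 0 1) :=
    integral_nonneg fun _ => (Real.exp_pos _).le
  unfold deviationConst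
  positivity

/-- With high probability the second moment matrix is close to its expectation in operator norm:
the deviations at the points of a net of the unit sphere, and a union bound over the net. -/
lemma exists_event_close [IsProbabilityMeasure P] (h : IsSample P f β y x)
    (hf : Measurable f) (hb : ∀ z, f z ∈ Set.Icc (-1 : ℝ) 1) (hβ : ‖β‖ = 1)
    (hn : Even n) (hn0 : 0 < n) (hpn : 2 * (p : ℝ) / n ≤ (1 / 128) ^ 2) :
    ∃ A : Set Ω, MeasurableSet A ∧ 1 - 2 * Real.exp (-p) ≤ P.real A ∧
      ∀ ω ∈ A, ∀ u, |⟪Matrix.toEuclideanLin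
          (secondMoment (fun i => y i ω) (fun i => x i ω)) u, u⟫ -
          (4 * (1 - mu f 0 ^ 2) * ‖u‖ ^ 2 + 4 * phi f * ⟪u, β⟫ ^ 2)| ≤
        deviationConst * √((p : ℝ) / n) * ‖u‖ ^ 2 := by
  obtain ⟨D, hDcard, hD1, hDnet⟩ := exists_net_sphere (E := EuclideanSpace ℝ (Fin p))
  rw [finrank_euclideanSpace_fin] at hDcard
  set k := 2 * (∫ z, Real.exp (z ^ 2 / 4) ∂(gaussianReal 0 1)) / (1 / 128) ^ 2 with hk
  set s := √(2 * (p : ℝ) / n) with hs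
  have hn2 : ((n / 2 : ℕ) : ℝ) = n / 2 := by
    obtain ⟨r, hr⟩ := hn
    have : n / 2 = r := by omega
    rw [this, hr]; push_cast; ring
  have hnr : (0 : ℝ) < n := by exact_mod_cast hn0
  have hs1 : s ≤ 1 / 128 := by
    rw [hs, ← Real.sqrt_sq (show (0 : ℝ) ≤ 1 / 128 by norm_num)]
    exact Real.sqrt_le_sqrt hpn
  have hs2 : n / 2 * s ^ 2 = (p : ℝ) := by
    rw [hs, Real.sq_sqrt (by positivity)]; field_simp
  -- with this deviation the Chernoff exponent is `-(k + 3) p + k p = -3 p`, as `(n / 2) s² = p`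
  let δ := (k + 3) * s
  let Bad : EuclideanSpace ℝ (Fin p) → Set Ω := fun v =>
    {ω | (n / 2 : ℕ) * δ ≤ |∑ i : Fin (n / 2),
      (y ⟨2 * i + 1, by omega⟩ ω - y ⟨2 * i, by omega⟩ ω) ^ 2 *
        ⟪x ⟨2 * i + 1, by omega⟩ ω - x ⟨2 * i, by omega⟩ ω, v⟫ ^ 2
        - (n / 2 : ℕ) * (4 * (1 - mu f 0 ^ 2) * ‖v‖ ^ 2 + 4 * phi f * ⟪v, β⟫ ^ 2)|}
  have hBadm : ∀ v, MeasurableSet (Bad v) := by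
    intro v
    refine measurableSet_le measurable_const ?_
    have hsum : Measurable fun ω => ∑ i : Fin (n / 2),
        (y ⟨2 * i + 1, by omega⟩ ω - y ⟨2 * i, by omega⟩ ω) ^ 2 *
        ⟪x ⟨2 * i + 1, by omega⟩ ω - x ⟨2 * i, by omega⟩ ω, v⟫ ^ 2 :=
      Finset.measurable_sum _ fun i _ =>
        (((h.model _).measurable_Y.sub (h.model _).measurable_Y).pow_const 2).mul
        ((((h.model _).measurable_X.sub (h.model _).measurable_X).inner
          measurable_const).pow_const 2)
    exact continuous_abs.measurable.comp (hsum.sub measurable_const)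
  have hBad : ∀ v ∈ D, P.real (Bad v) ≤ 2 * Real.exp (-(3 * p)) := by
    intro v hv
    refine (measure_quadratic_deviation_le h hf hb hβ (hD1 v hv) (Real.sqrt_nonneg _)
      hs1).trans (le_of_eq ?_)
    rw [hn2]
    congr 2
    change -(s * (n / 2 * ((k + 3) * s))) + n / 2 * (k * s ^ 2) = _
    linear_combination (-3) * hs2
  refine ⟨(⋃ v ∈ D, Bad v)ᶜ, (D.measurableSet_biUnion fun v _ => hBadm v).compl, ?_, ?_⟩
  · have hU : P.real (⋃ v ∈ D, Bad v) ≤ 2 * Real.exp (-p) := by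
      calc _ ≤ ∑ v ∈ D, P.real (Bad v) := measureReal_biUnion_finset_le D Bad
        _ ≤ ∑ _v ∈ D, 2 * Real.exp (-(3 * p)) := Finset.sum_le_sum hBad
        _ = D.card * (2 * Real.exp (-(3 * p))) := by rw [Finset.sum_const, nsmul_eq_mul]
        _ ≤ Real.exp (p * 2) * (2 * Real.exp (-(3 * p))) := by
          gcongr
          have h5 : (5 : ℝ) ≤ Real.exp 2 := by
            have := Real.quadratic_le_exp_of_nonneg (x := 2) (by norm_num)
            linarith
          calc (D.card : ℝ) ≤ 5 ^ p := by exact_mod_cast hDcard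
            _ ≤ Real.exp 2 ^ p := by gcongr
            _ = _ := by rw [← Real.exp_nat_mul]
        _ = 2 * (Real.exp (p * 2) * Real.exp (-(3 * p))) := by ring
        _ = _ := by rw [← Real.exp_add]; ring_nf
    rw [measureReal_compl (D.measurableSet_biUnion fun v _ => hBadm v)]
    simp only [probReal_univ]
    linarith
  · intro ω hω u
    have hsym := isSymmetric_secondMoment (fun i => y i ω) (fun i => x i ω)
    obtain ⟨A, hA, -, hAq⟩ := exists_sub_spike hsym (4 * (1 - mu f 0 ^ 2)) (4 * phi f) β
    have hnet : ∀ v ∈ D, |⟪A v, v⟫| ≤ δ := by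
      intro v hv
      have hωv : ω ∉ Bad v := fun hmem => hω (Set.mem_biUnion hv hmem)
      simp only [Bad, Set.mem_ofPred_eq, not_le] at hωv
      rw [hn2] at hωv
      rw [hAq, inner_secondMoment_apply]
      set m := 4 * (1 - mu f 0 ^ 2) * ‖v‖ ^ 2 + 4 * phi f * ⟪v, β⟫ ^ 2
      simp only [← pow_two]
      set S := ∑ i : Fin (n / 2), (y ⟨2 * i + 1, by omega⟩ ω - y ⟨2 * i, by omega⟩ ω) ^ 2 *
        ⟪x ⟨2 * i + 1, by omega⟩ ω - x ⟨2 * i, by omega⟩ ω, v⟫ ^ 2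
      have e : 2 / (n : ℝ) * S - m = 2 / n * (S - n / 2 * m) := by field_simp
      rw [e, abs_mul, abs_of_pos (by positivity)]
      calc 2 / (n : ℝ) * |S - n / 2 * m| ≤ 2 / n * (n / 2 * δ) := by gcongr
        _ = δ := by field_simp
    have hfin := abs_inner_le_of_net hA hD1 hDnet hnet u
    rw [hAq] at hfin
    refine hfin.trans (le_of_eq ?_)
    have : s = √2 * √((p : ℝ) / n) := by
      rw [hs, mul_div_assoc, Real.sqrt_mul (by norm_num)]
    simp only [δ, this, deviationConst, ← hk]
    ring

end Event

/-! ### The parameters `γ` and `ξ`, and the deterministic bound -/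

section Parameters

variable {f : ℝ → ℝ}

lemma mu_zero_sq_le_one (hb : ∀ z, f z ∈ Set.Icc (-1 : ℝ) 1) : mu f 0 ^ 2 ≤ 1 := by
  have h : ‖mu f 0‖ ≤ 1 * (gaussianReal 0 1).real Set.univ :=
    norm_integral_le_of_norm_le_const (ae_of_all _ fun z => by
      simpa [Real.norm_eq_abs] using abs_le.mpr (hb z))
  rw [probReal_univ, mul_one, Real.norm_eq_abs] at h
  exact (sq_le_one_iff_abs_le_one _).mpr h

lemma gam_pos (hμ : mu f 0 ^ 2 ≤ 1) (hφ : 0 < phi f) : 0 < gam f := by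
  have : 0 ≤ (1 - mu f 0 ^ 2) / (phi f + 1 - mu f 0 ^ 2) :=
    div_nonneg (by linarith) (by linarith)
  unfold gam
  linarith

lemma gam_lt_one (hμ : mu f 0 ^ 2 ≤ 1) (hφ : 0 < phi f) : gam f < 1 := by
  have : (1 - mu f 0 ^ 2) / (phi f + 1 - mu f 0 ^ 2) < 1 := by
    rw [div_lt_one (by linarith)]; linarith
  unfold gam
  linarith

/-- Multiplying out the definition, `ξ = φ / (2 (1 + γ) (φ + 1 - μ₀²))`. -/
lemma xi_mul_eq (hμ : mu f 0 ^ 2 ≤ 1) (hφ : 0 < phi f) :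
    xi f * ((1 + gam f) * (phi f + 1 - mu f 0 ^ 2)) = phi f / 2 := by
  have hL : 0 < phi f + 1 - mu f 0 ^ 2 := by linarith
  have hγ : gam f * (phi f + 1 - mu f 0 ^ 2) =
      ((1 - mu f 0 ^ 2) + (phi f + 1 - mu f 0 ^ 2)) / 2 := by
    unfold gam
    field_simp
  have h1 := gam_pos hμ hφ
  rw [xi, div_mul_cancel₀ _ (by positivity)]
  linarith

lemma xi_pos (hμ : mu f 0 ^ 2 ≤ 1) (hφ : 0 < phi f) : 0 < xi f := by
  have h := xi_mul_eq hμ hφ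
  have h1 := gam_pos hμ hφ
  have h2 : 0 < (1 + gam f) * (phi f + 1 - mu f 0 ^ 2) := mul_pos (by linarith) (by linarith)
  exact pos_of_mul_pos_left (by rw [h]; linarith) h2.le

lemma xi_mul_le (hμ : mu f 0 ^ 2 ≤ 1) (hφ : 0 < phi f) :
    xi f * (phi f + 1 - mu f 0 ^ 2) ≤ phi f / 2 := by
  have h := xi_mul_eq hμ hφ
  have h1 := mul_pos (mul_pos (xi_pos hμ hφ) (gam_pos hμ hφ))
    (show 0 < phi f + 1 - mu f 0 ^ 2 by linarith)
  linarith

lemma xi_le_one (hμ : mu f 0 ^ 2 ≤ 1) (hφ : 0 < phi f) : xi f ≤ 1 := by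
  have h := xi_mul_le hμ hφ
  by_contra hc
  push Not at hc
  have := mul_lt_mul_of_pos_right hc (show 0 < phi f + 1 - mu f 0 ^ 2 by linarith)
  linarith

/-- The tolerance `ξ` is chosen such that a perturbation of relative size `ξ` leaves the quotient
of the two largest eigenvalues below `γ`. -/
lemma eigenvalue_ratio (hμ : mu f 0 ^ 2 ≤ 1) (hφ : 0 < phi f) :
    (1 - mu f 0 ^ 2) + xi f * (phi f + 1 - mu f 0 ^ 2) =
      gam f * ((phi f + 1 - mu f 0 ^ 2) - xi f * (phi f + 1 - mu f 0 ^ 2)) := by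
  have h := xi_mul_eq hμ hφ
  have hL : 0 < phi f + 1 - mu f 0 ^ 2 := by linarith
  have hγ : gam f * (phi f + 1 - mu f 0 ^ 2) =
      ((1 - mu f 0 ^ 2) + (phi f + 1 - mu f 0 ^ 2)) / 2 := by
    unfold gam
    field_simp
  linear_combination h - hγ

end Parameters

/-- The deterministic part: a matrix whose quadratic form is close to the one of its expectation
has power iterates that approach the parameter. -/
lemma norm_powerIterate_sub_spike_le {p : ℕ} {f : ℝ → ℝ} (hμ : mu f 0 ^ 2 ≤ 1) (hφ : 0 < phi f)
    {M : Matrix (Fin p) (Fin p) ℝ} {β b₀ v : EuclideanSpace ℝ (Fin p)} {δ : ℝ}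
    (hM : (Matrix.toEuclideanLin M).IsSymmetric)
    (hpos : ∀ w, 0 ≤ inner ℝ (Matrix.toEuclideanLin M w) w) (hβ : ‖β‖ = 1)
    (hclose : ∀ w, |inner ℝ (Matrix.toEuclideanLin M w) w -
      (4 * (1 - mu f 0 ^ 2) * ‖w‖ ^ 2 + 4 * phi f * inner ℝ w β ^ 2)| ≤ δ * ‖w‖ ^ 2)
    (hδ0 : 0 ≤ δ) (hδ : δ ≤ 4 * xi f * (phi f + 1 - mu f 0 ^ 2))
    (hb : ‖b₀‖ = 1) (hv : IsLeadingEigenvector M v) (hvβ : 0 ≤ inner ℝ v β)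
    (h0 : inner ℝ b₀ v ≠ 0) (t : ℕ) :
    ‖powerIterate M b₀ t - Real.sign (inner ℝ b₀ v) • β‖ ≤ δ / phi f +
      √((1 - (inner ℝ b₀ v) ^ 2) / (inner ℝ b₀ v) ^ 2) * gam f ^ t := by
  obtain ⟨hv1, l, hl, hmax⟩ := hv
  have hspike : IsPerturbedSpike (Matrix.toEuclideanLin M) (4 * (1 - mu f 0 ^ 2)) (4 * phi f) δ β
      l v :=
    { symm := hM
      nonneg := hpos
      norm_spike := hβ
      close := hclose
      norm_vec := hv1
      apply_vec := hl.apply_eq_smul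
      le_top := inner_apply_self_le_of_forall_hasEigenvalue_le hM hmax }
  have hγ := gam_pos hμ hφ
  have hratio := eigenvalue_ratio hμ hφ
  have hξ := xi_mul_le hμ hφ
  have hle := hspike.le_eigenvalue
  have hδ2 : δ ≤ 2 * phi f := by linarith
  have hl0 : 0 < l := by linarith
  have hgl : 4 * (1 - mu f 0 ^ 2) + δ ≤ gam f * l := by
    have : gam f * (4 * ((phi f + 1 - mu f 0 ^ 2) - xi f * (phi f + 1 - mu f 0 ^ 2))) ≤
        gam f * l := by gcongr; linarith
    linarith
  have h1 := hspike.norm_powerIterate_sub_le (by linarith) hl0 hgl hb h0 t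
  have h2 := hspike.norm_sub_spike_le (by linarith) hvβ
  have h3 : √2 * (δ / (4 * phi f - δ)) ≤ δ / phi f := by
    have hs : √2 ≤ 2 := by
      rw [Real.sqrt_le_left (by norm_num)]; norm_num
    calc √2 * (δ / (4 * phi f - δ)) ≤ 2 * (δ / (2 * phi f)) := by
          refine mul_le_mul hs ?_ (div_nonneg hδ0 (by linarith)) (by norm_num)
          exact div_le_div_of_nonneg_left hδ0 (by positivity) (by linarith)
      _ = δ / phi f := by field_simp
  have hsgn : |Real.sign (inner ℝ b₀ v)| = 1 := by
    rcases lt_or_gt_of_ne h0 with h | h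
    · rw [Real.sign_of_neg h]; norm_num
    · rw [Real.sign_of_pos h]; norm_num
  -- the optimization error of the iteration plus the statistical error of `v`
  calc _ = ‖(powerIterate M b₀ t - Real.sign (inner ℝ b₀ v) • v) +
          Real.sign (inner ℝ b₀ v) • (v - β)‖ := by congr 1; rw [smul_sub]; abel
    _ ≤ _ := norm_add_le _ _
    _ ≤ _ := by
      rw [norm_smul, Real.norm_eq_abs, hsgn, one_mul]
      linarith

end OneBit

theorem mainTheorem1 :
    ∃ C₂ : ℝ, 0 < C₂ ∧
    ∀ c : ℝ, 0 < c →
    ∃ C₁ C₃ : ℝ, 0 < C₁ ∧ 0 < C₃ ∧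
    ∀ f : ℝ → ℝ, Measurable f → (∀ z, f z ∈ Set.Icc (-1 : ℝ) 1) →
      0 < OneBit.phi f → c ≤ OneBit.phi f + 1 - OneBit.mu f 0 ^ 2 →
      (0 < OneBit.gam f ∧ OneBit.gam f < 1) ∧
      ∀ (p n : ℕ), Even n → C₁ * p / OneBit.xi f ^ 2 ≤ n →
      ∀ (βstar : EuclideanSpace ℝ (Fin p)), ‖βstar‖ = 1 →
      ∀ {Ω : Type*} [MeasurableSpace Ω] (P : Measure Ω) [IsProbabilityMeasure P]
        (y : Fin n → Ω → ℝ) (x : Fin n → Ω → EuclideanSpace ℝ (Fin p)),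
      OneBit.IsSample P f βstar y x →
      ∃ A : Set Ω, MeasurableSet A ∧ 1 - 2 * Real.exp (-C₂ * p) ≤ P.real A ∧
        ∀ ω ∈ A, ∀ M : Matrix (Fin p) (Fin p) ℝ,
          M = OneBit.secondMoment (fun i => y i ω) (fun i => x i ω) →
        ∀ β₀ βhat : EuclideanSpace ℝ (Fin p), ‖β₀‖ = 1 →
          OneBit.IsLeadingEigenvector M βhat → 0 ≤ inner ℝ βhat βstar →
        ∀ α : ℝ, α = inner ℝ β₀ βhat → α ≠ 0 →
          (∀ t : ℕ, 1 ≤ t →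
            ‖OneBit.powerIterate M β₀ t - Real.sign α • βstar‖ ≤
              C₃ * ((OneBit.phi f + 1 - OneBit.mu f 0 ^ 2) / OneBit.phi f) * √((p : ℝ) / n)
                + √((1 - α ^ 2) / α ^ 2) * OneBit.gam f ^ t) ∧
          (∀ᶠ t : ℕ in atTop,
            ‖OneBit.powerIterate M β₀ t - Real.sign α • βstar‖ ≤
              2 * C₃ * ((OneBit.phi f + 1 - OneBit.mu f 0 ^ 2) / OneBit.phi f)
                * √((p : ℝ) / n)) := by
  refine ⟨1, one_pos, fun c hc => ?_⟩
  have hB := OneBit.deviationConst_pos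
  set B := OneBit.deviationConst
  -- The first summand makes the deviation `B √(p / n)` at most `4 ξ (φ + 1 - μ₀²)`; the second one
  -- keeps the Chernoff parameter `√(2 p / n)` inside the range of the exponential moment.
  refine ⟨(B / (4 * c)) ^ 2 + 2 * 128 ^ 2, B / c, by positivity, by positivity,
    fun f hf hb hφ hcL => ?_⟩
  have hμ := OneBit.mu_zero_sq_le_one hb
  have hγ0 := OneBit.gam_pos hμ hφ
  have hγ1 := OneBit.gam_lt_one hμ hφ
  refine ⟨⟨hγ0, hγ1⟩, ?_⟩
  intro p n hn hnp βstar hβ Ω _ P _ y x hsample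
  have hξ := OneBit.xi_pos hμ hφ
  have hξ1 := OneBit.xi_le_one hμ hφ
  set ξ := OneBit.xi f
  set L := OneBit.phi f + 1 - OneBit.mu f 0 ^ 2 with hL
  have hL0 : 0 < L := hc.trans_le hcL
  have hp : 0 < p := by
    rcases Nat.eq_zero_or_pos p with rfl | hp
    · rw [Subsingleton.elim βstar 0, norm_zero] at hβ
      exact absurd hβ zero_ne_one
    · exact hp
  have hpr : (0 : ℝ) < p := by exact_mod_cast hp
  have hnr : (0 : ℝ) < n := lt_of_lt_of_le (by positivity) hnp
  have hn0 : 0 < n := by exact_mod_cast hnr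
  have hpn : ((B / (4 * c)) ^ 2 + 2 * 128 ^ 2) * ((p : ℝ) / n) ≤ ξ ^ 2 := by
    rw [div_le_iff₀ (by positivity)] at hnp
    rw [← mul_div_assoc, div_le_iff₀ hnr]
    linarith
  have hpn0 : 0 ≤ (p : ℝ) / n := by positivity
  have hsmall : 2 * (p : ℝ) / n ≤ (1 / 128) ^ 2 := by
    have h1 : ξ ^ 2 ≤ 1 := pow_le_one₀ hξ.le hξ1
    have h2 : 0 ≤ (B / (4 * c)) ^ 2 * ((p : ℝ) / n) := by positivity
    rw [mul_div_assoc]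
    linarith
  have hδ : B * √((p : ℝ) / n) ≤ 4 * ξ * L := by
    have h1 : B / (4 * c) * √((p : ℝ) / n) ≤ ξ := by
      refine abs_le_of_sq_le_sq' ?_ hξ.le |>.2
      rw [mul_pow, Real.sq_sqrt hpn0]
      linarith
    have h2 : B * √((p : ℝ) / n) = 4 * c * (B / (4 * c) * √((p : ℝ) / n)) := by field_simp
    calc B * √((p : ℝ) / n) ≤ 4 * c * ξ := by rw [h2]; gcongr
      _ ≤ 4 * L * ξ := by gcongr
      _ = _ := by ring
  have hC₃ : B * √((p : ℝ) / n) / OneBit.phi f ≤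
      B / c * (L / OneBit.phi f) * √((p : ℝ) / n) := by
    calc B * √((p : ℝ) / n) / OneBit.phi f
        = 1 * (B * √((p : ℝ) / n) / OneBit.phi f) := (one_mul _).symm
      _ ≤ L / c * (B * √((p : ℝ) / n) / OneBit.phi f) := by
        gcongr; rwa [one_le_div hc]
      _ = _ := by ring
  obtain ⟨A, hAm, hAP, hA⟩ := OneBit.exists_event_close hsample hf hb hβ hn hn0 hsmall
  refine ⟨A, hAm, by rwa [neg_one_mul], ?_⟩
  rintro ω hω M rfl β₀ βhat hβ₀ hlead hsign α rfl hα
  have hmain : ∀ t : ℕ, _ := fun t => (OneBit.norm_powerIterate_sub_spike_le hμ hφ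
    (OneBit.isSymmetric_secondMoment _ _) (OneBit.inner_secondMoment_self_nonneg _ _) hβ
    (hA ω hω) (by positivity) hδ hβ₀ hlead hsign hα t).trans (add_le_add_left hC₃ _)
  refine ⟨fun t _ => hmain t, ?_⟩
  have hlim : Tendsto (fun t : ℕ => √((1 - (inner ℝ β₀ βhat) ^ 2) / (inner ℝ β₀ βhat) ^ 2) *
      OneBit.gam f ^ t) atTop (nhds 0) := by
    simpa using (tendsto_pow_atTop_nhds_zero_of_lt_one hγ0.le hγ1).const_mul
      (√((1 - (inner ℝ β₀ βhat) ^ 2) / (inner ℝ β₀ βhat) ^ 2))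
  have hpos : 0 < B / c * (L / OneBit.phi f) * √((p : ℝ) / n) := by positivity
  filter_upwards [hlim.eventually_lt_const hpos] with t ht
  have := hmain t
  linarith
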